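/- Let $\mathbb F=\mathbb F_q$ be the finite field of order $q$, let $\mathbb H=\mathbb F^{2\times2}$ be the split quaternion algebra with standard involution $\overline{\left(\begin{smallmatrix}a&b\\c&d\end{smallmatrix}\right)}=\left(\begin{smallmatrix}d&-b\\-c&a\end{smallmatrix}\right)$, and let $\mathbb O=\mathbb H\oplus\mathbb Hw$ be the split octonion algebra over $\mathbb F$, with multiplication $(a+xw)(b+yw)=ab+\bar yx+(ya+x\bar b)w$, norm $N(a+xw)=\det a-\det x$ and polar form $(u|v)=N(u+v)-N(u)-N(v)$. Subalgebras of $\mathbb O$ are linear subspaces closed under multiplication (not necessarily containing $1$), and $\operatorname{Aut}\mathbb O$ is the group of all $\mathbb F$-algebra automorphisms of $\mathbb O$. Let - $\mathcal D$ be the set of all $2$-dimensional subalgebras $D$ of $\mathbb O$ such that $N|_D$ is anisotropic and has non-trivial polarization; - $\mathcal X$ be the set of all subalgebras of the form $D+Dz$, where $D\in\mathcal D$ and $z\in D^\perp$ with $z^2=0\neq z$; - $\mathcal H$ be the set of all quaternion subalgebras of $\mathbb O$, that is, of all $4$-dimensional subalgebras containing $1$ on which the polar form is non-degenerate. Consider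 the incidence structures $\mathcal U=(\mathcal D,\mathcal X,<)$ and $\mathcal V=(\mathcal D,\mathcal X\cup\mathcal H,<)$, where $<$ is proper inclusion. For $D\in\mathcal D$, $\mathcal Y\in\{\mathcal X,\mathcal H\}$ and $Z\in\mathcal Y$ put $\mathcal D_Z=\{D\in\mathcal D: D<Z\}$ and $\mathcal Y_D=\{Y\in\mathcal Y: D<Y\}$. Then the group $\operatorname{Aut}\mathbb O$ acts (by $S\mapsto\alpha(S)$) by automorphisms both on $\mathcal U$ and on $\mathcal V$. Moreover: 1. Each one of the sets $\mathcal D$, $\mathcal X$, and $\mathcal H$ is an orbit under $\operatorname{Aut}\mathbb O$, of length $$|\mathcal D|=\tfrac12q^3(q^2+q+1)(q-1),$$ $$|\mathcal X|=\tfrac12q(q^2+q+1)(q-1)(q+1)(q^2-q+1),$$ $$|\mathcal H|=q^4(q^2+q+1)(q^2-q+1),$$ respectively. 2. For $D\in\mathcal D$, $X\in\mathcal X$, and $H\in\mathcal H$ we have $|\mathcal X_D|=q^3+1$, $|\mathcal H_D|=q^2(q^2-q+1)$, $|\mathcal D_X|=q^2$, and $|\mathcal D_H|=\tfrac12q(q-1)$.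 -/

import Mathlib

universe u

/-- The split quaternion algebra `ℍ = F^{2×2}`. -/
abbrev SplitQuat (F : Type u) : Type u := Matrix (Fin 2) (Fin 2) F

namespace SplitQuat

/-- The standard involution of `ℍ`. -/
def conj {F : Type u} [Field F] (a : SplitQuat F) : SplitQuat F :=
  !![a 1 1, -a 0 1; -a 1 0, a 0 0]

theorem conj_add {F : Type u} [Field F] (a b : SplitQuat F) :
    conj (a + b) = conj a + conj b := by
  ext i j; fin_cases i <;> fin_cases j <;> simp [conj] <;> ring

theorem conj_smul {F : Type u} [Field F] (c : F) (a : SplitQuat F) :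
    conj (c • a) = c • conj a := by
  ext i j; fin_cases i <;> fin_cases j <;> simp [conj]

theorem conj_zero {F : Type u} [Field F] : conj (0 : SplitQuat F) = 0 := by
  ext i j; fin_cases i <;> fin_cases j <;> simp [conj]

theorem conj_one {F : Type u} [Field F] : conj (1 : SplitQuat F) = 1 := by
  ext i j; fin_cases i <;> fin_cases j <;> simp [conj]

end SplitQuat

/-- The split octonion algebra `𝕆 = ℍ ⊕ ℍ w`; the pair `(a, x)` stands for `a + x w`. -/
def Oct (F : Type u) : Type u := SplitQuat F × SplitQuat F

namespace Oct

open SplitQuat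

theorem ext {F : Type u} {u v : Oct F} (h₁ : u.1 = v.1) (h₂ : u.2 = v.2) :
    u = v := Prod.ext h₁ h₂

variable {F : Type u} [Field F]

instance : AddCommGroup (Oct F) := inferInstanceAs (AddCommGroup (SplitQuat F × SplitQuat F))

instance : Module F (Oct F) := inferInstanceAs (Module F (SplitQuat F × SplitQuat F))

/-- `(a + xw)(b + yw) = ab + ȳx + (ya + x b̄)w`. -/
instance : Mul (Oct F) :=
  ⟨fun u v => (u.1 * v.1 + conj v.2 * u.2, v.2 * u.1 + u.2 * conj v.1)⟩

instance : One (Oct F) := ⟨((1 : SplitQuat F), (0 : SplitQuat F))⟩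

theorem add_fst (u v : Oct F) : (u + v).1 = u.1 + v.1 := rfl
theorem add_snd (u v : Oct F) : (u + v).2 = u.2 + v.2 := rfl
theorem zero_fst : (0 : Oct F).1 = 0 := rfl
theorem zero_snd : (0 : Oct F).2 = 0 := rfl
theorem one_fst : (1 : Oct F).1 = 1 := rfl
theorem one_snd : (1 : Oct F).2 = 0 := rfl
theorem smul_fst (c : F) (u : Oct F) : (c • u).1 = c • u.1 := rfl
theorem smul_snd (c : F) (u : Oct F) : (c • u).2 = c • u.2 := rfl
theorem mul_fst (u v : Oct F) : (u * v).1 = u.1 * v.1 + conj v.2 * u.2 := rfl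
theorem mul_snd (u v : Oct F) : (u * v).2 = v.2 * u.1 + u.2 * conj v.1 := rfl

/-- The (not associative) unital ring structure of `𝕆`. -/
instance : NonAssocRing (Oct F) :=
  { (inferInstance : AddCommGroup (Oct F)), (inferInstance : Mul (Oct F)),
    (inferInstance : One (Oct F)) with
    left_distrib := fun u v t => by
      apply Oct.ext <;> simp only [mul_fst, mul_snd, add_fst, add_snd, conj_add, mul_add, add_mul] <;> abel
    right_distrib := fun u v t => by
      apply Oct.ext <;> simp only [mul_fst, mul_snd, add_fst, add_snd, mul_add, add_mul] <;> abel
    zero_mul := fun u => by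
      apply Oct.ext <;> simp only [mul_fst, mul_snd, zero_fst, zero_snd, mul_zero, zero_mul, add_zero]
    mul_zero := fun u => by
      apply Oct.ext <;> simp only [mul_fst, mul_snd, zero_fst, zero_snd, conj_zero, mul_zero, zero_mul,
        add_zero]
    one_mul := fun u => by
      apply Oct.ext <;> simp only [mul_fst, mul_snd, one_fst, one_snd, one_mul, mul_one, zero_mul,
        mul_zero, add_zero]
    mul_one := fun u => by
      apply Oct.ext <;> simp only [mul_fst, mul_snd, one_fst, one_snd, conj_zero, conj_one, mul_one,
        zero_mul, add_zero, zero_add] }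

instance : IsScalarTower F (Oct F) (Oct F) :=
  ⟨fun c u v => by
    apply Oct.ext <;> simp only [smul_eq_mul, mul_fst, mul_snd, smul_fst, smul_snd, smul_mul_assoc,
      mul_smul_comm, smul_add]⟩

instance : SMulCommClass F (Oct F) (Oct F) :=
  ⟨fun c u v => by
    apply Oct.ext <;> simp only [smul_eq_mul, mul_fst, mul_snd, smul_fst, smul_snd, smul_mul_assoc,
      mul_smul_comm, smul_add, conj_smul]⟩

/-- The norm `N(a + xw) = det a - det x`. -/
def norm (u : Oct F) : F := Matrix.det u.1 - Matrix.det u.2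

/-- The polar form `(u|v) = N(u + v) - N(u) - N(v)`. -/
def bil (u v : Oct F) : F := QuadraticMap.polar norm u v

variable (F) in
/-- Subalgebras of `𝕆`: subspaces closed under multiplication, not required to contain `1`. -/
abbrev Subalg : Type u := NonUnitalSubalgebra F (Oct F)

variable (F) in
/-- `Aut 𝕆`: the group of all `F`-linear multiplicative bijections of `𝕆`. -/
def Aut : Subgroup (Oct F ≃ₗ[F] Oct F) where
  carrier := {f | ∀ u v, f (u * v) = f u * f v}
  mul_mem' := fun {f g} hf hg u v => by
    change f (g (u * v)) = f (g u) * f (g v)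
    rw [hg, hf]
  one_mem' := fun _ _ => rfl
  inv_mem' := fun {f} hf u v => by
    change f.symm (u * v) = f.symm u * f.symm v
    rw [LinearEquiv.symm_apply_eq, hf]
    simp

/-- An automorphism as a homomorphism of (not necessarily unital) algebras. -/
def Aut.toHom (α : Aut F) : Oct F →ₙₐ[F] Oct F where
  toFun := fun u => α.1 u
  map_smul' := fun c u => α.1.map_smul c u
  map_zero' := α.1.map_zero
  map_add' := fun u v => α.1.map_add u v
  map_mul' := fun u v => α.2 u v

/-- The action of `Aut 𝕆` on subalgebras: `α • S` is the image of `S` under `α`. -/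
instance : MulAction (Aut F) (Subalg F) where
  smul α S := S.map (Aut.toHom α)
  one_smul _ := SetLike.coe_injective (Set.image_id _)
  mul_smul α β S := SetLike.coe_injective (Set.image_comp (Aut.toHom α) (Aut.toHom β) (S : Set (Oct F)))

variable (F) in
/-- `𝒟`: the two-dimensional subalgebras on which the norm is anisotropic and has
non-trivial polarization. -/
def setD : Set (Subalg F) :=
  {D | Module.finrank F D.toSubmodule = 2 ∧ (∀ x ∈ D, norm x = 0 → x = 0) ∧
    ∃ x ∈ D, ∃ y ∈ D, bil x y ≠ 0}

variable (F) in
/-- `𝒳`: the subalgebras of the form `D + Dz` with `D ∈ 𝒟`, `z ∈ D^⊥` and `z² = 0 ≠ z`. -/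
def setX : Set (Subalg F) :=
  {X | ∃ D ∈ setD F, ∃ z : Oct F, (∀ d ∈ D, bil d z = 0) ∧ z * z = 0 ∧ z ≠ 0 ∧
    (X : Set (Oct F)) = {x | ∃ a ∈ D, ∃ b ∈ D, x = a + b * z}}

variable (F) in
/-- `ℋ`: the quaternion subalgebras, that is, the unital four-dimensional subalgebras that are
composition algebras (the restriction of the norm has non-degenerate polarization). -/
def setH : Set (Subalg F) :=
  {H | 1 ∈ H ∧ Module.finrank F H.toSubmodule = 4 ∧
    ∀ x ∈ H, (∀ y ∈ H, bil x y = 0) → x = 0}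

theorem mem_smul_iff (α : Aut F) (S : Subalg F) (y : Oct F) :
    y ∈ α • S ↔ ∃ x ∈ S, α.1 x = y := Iff.rfl

end Oct

/-- An incidence structure: points, blocks, and an incidence relation between them. -/
structure IncStruct where
  /-- The points. -/
  Point : Type u
  /-- The blocks. -/
  Block : Type u
  /-- The incidence relation. -/
  inc : Point → Block → Prop

/-- The automorphism group of an incidence structure: pairs of permutations of points and of
blocks that preserve incidence and non-incidence. -/
def IncStruct.Aut (S : IncStruct.{u}) : Subgroup (Equiv.Perm S.Point × Equiv.Perm S.Block) where
  carrier := {f | ∀ p b, S.inc (f.1 p) (f.2 b) ↔ S.inc p b}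
  mul_mem' := fun {f g} hf hg p b => by
    change S.inc (f.1 (g.1 p)) (f.2 (g.2 b)) ↔ _
    rw [hf, hg]
  one_mem' := fun _ _ => Iff.rfl
  inv_mem' := fun {f} hf p b => by
    have h := hf (f.1.symm p) (f.2.symm b)
    rw [Equiv.apply_symm_apply, Equiv.apply_symm_apply] at h
    exact h.symm

namespace Oct

/-- `𝒰 = (𝒟, 𝒳, <)`. -/
def incU (F : Type u) [Field F] : IncStruct.{u} where
  Point := setD F
  Block := setX F
  inc D X := D.1 < X.1

/-- `𝒱 = (𝒟, 𝒳 ∪ ℋ, <)`. -/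
def incV (F : Type u) [Field F] : IncStruct.{u} where
  Point := setD F
  Block := ↥(setX F ∪ setH F)
  inc D Y := D.1 < Y.1

end Oct

set_option linter.unusedSectionVars false

/-! Fix `n` such that `x ^ 2 - x + n` has no root in the field. A finite field has only one
quadratic extension, so every member of `setD F` is `F[u]` for some `u` of trace 1 and norm `n`, and
it contains exactly two such elements, `u` and `1 - u` (`mem_setD_iff`, `lineMap_root_iff`). The
blocks through it are the spaces `F[u] + F[u]z` with `z ≠ 0` orthogonal to `F[u]`: isotropic `z`
gives `setX F`, anisotropic `z` gives `setH F`.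

Transitivity is the Cayley–Dickson process. If `w` is orthogonal to a subalgebra containing 1 and
closed under conjugation, the product on `f + f w` depends only on the subalgebra and on `norm w`
(`IsEmb.double`). Doubling `F[u]` by `v` and then by `w`, both of non-zero norm, gives all of `𝕆`,
so two generating triples with equal norms are related by an automorphism (`IsTriple.exists_aut`).
The norm form of `F[u]` is universal, so the norms of `v` and `w` can be prescribed. Each `D`, `X`
or `H` is then described by a triple; an isotropic `z` is, up to a factor from `F[u]`, a sum `v + w`
with norms 1 and -1 (`exists_triple_of_isotropic`).

The numbers come from double counting. In coordinates one counts elements of trace 1 and norm `n` in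
`𝕆` and in `ℍ`, and isotropic vectors in the 6-dimensional space orthogonal to `F[u]`. Each root
lies in one `D`, and each non-zero vector orthogonal to `D` lies in at most one block of a given
kind through `D`. Counting incident pairs then gives the local parameters, and from them the sizes
of the orbits. -/

namespace Oct

open SplitQuat

variable {F : Type u} [Field F]

/-! ### Conjugation, trace and the composition identities -/

/-- The standard involution of `𝕆`. -/
def cj (u : Oct F) : Oct F := (conj u.1, -u.2)

/-- The trace of `𝕆`. -/
def tr (u : Oct F) : F := u.1 0 0 + u.1 1 1

theorem cj_fst (u : Oct F) : (cj u).1 = conj u.1 := rfl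
theorem cj_snd (u : Oct F) : (cj u).2 = -u.2 := rfl
theorem sub_fst (u v : Oct F) : (u - v).1 = u.1 - v.1 := rfl
theorem sub_snd (u v : Oct F) : (u - v).2 = u.2 - v.2 := rfl
theorem norm_eq (u : Oct F) : norm u =
    u.1 0 0 * u.1 1 1 - u.1 0 1 * u.1 1 0 - (u.2 0 0 * u.2 1 1 - u.2 0 1 * u.2 1 0) := by
  simp [norm, Matrix.det_fin_two]

theorem bil_eq (u v : Oct F) : bil u v =
    u.1 0 0 * v.1 1 1 + u.1 1 1 * v.1 0 0 - u.1 0 1 * v.1 1 0 - u.1 1 0 * v.1 0 1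
    - (u.2 0 0 * v.2 1 1 + u.2 1 1 * v.2 0 0 - u.2 0 1 * v.2 1 0 - u.2 1 0 * v.2 0 1) := by
  simp only [bil, QuadraticMap.polar, norm_eq, add_fst, add_snd, Matrix.add_apply]
  ring

theorem _root_.SplitQuat.conj_apply (a : SplitQuat F) : conj a 0 0 = a 1 1 ∧ conj a 0 1 = -a 0 1 ∧
    conj a 1 0 = -a 1 0 ∧ conj a 1 1 = a 0 0 :=
  ⟨rfl, rfl, rfl, rfl⟩

theorem ext_coord {u v : Oct F} (h : ∀ i j, u.1 i j = v.1 i j) (h' : ∀ i j, u.2 i j = v.2 i j) :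
    u = v :=
  Oct.ext (Matrix.ext h) (Matrix.ext h')

theorem norm_add (u v : Oct F) : norm (u + v) = norm u + norm v + bil u v := by
  simp only [bil, QuadraticMap.polar]; ring

theorem bil_comm (u v : Oct F) : bil u v = bil v u := by
  simp only [bil_eq]; ring

theorem bil_add_left (u v z : Oct F) : bil (u + v) z = bil u z + bil v z := by
  simp only [bil_eq, add_fst, add_snd, Matrix.add_apply]; ring

theorem bil_smul_left (c : F) (u z : Oct F) : bil (c • u) z = c * bil u z := by
  simp only [bil_eq, smul_fst, smul_snd, Matrix.smul_apply, smul_eq_mul]; ring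

theorem bil_add_right (z u v : Oct F) : bil z (u + v) = bil z u + bil z v := by
  simp only [bil_comm z, bil_add_left]

theorem bil_smul_right (c : F) (z u : Oct F) : bil z (c • u) = c * bil z u := by
  simp only [bil_comm z, bil_smul_left]

theorem bil_self (u : Oct F) : bil u u = 2 * norm u := by
  simp only [bil_eq, norm_eq]; ring

theorem norm_smul (c : F) (u : Oct F) : norm (c • u) = c ^ 2 * norm u := by
  simp only [norm_eq, smul_fst, smul_snd, Matrix.smul_apply, smul_eq_mul]; ring

theorem bil_one_left (u : Oct F) : bil 1 u = tr u := by
  simp [bil_eq, tr, one_fst, one_snd]; ring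

theorem norm_one : norm (1 : Oct F) = 1 := by
  simp [norm_eq, one_fst, one_snd]

theorem norm_zero : norm (0 : Oct F) = 0 := by
  simp [norm_eq, zero_fst, zero_snd]

theorem cj_one : cj (1 : Oct F) = 1 := by
  apply ext_coord <;> simp only [Fin.forall_fin_two] <;> refine ⟨⟨?_, ?_⟩, ?_, ?_⟩ <;>
    simp [cj_fst, cj_snd, one_fst, one_snd, conj_apply]

theorem add_cj (u : Oct F) : u + cj u = tr u • (1 : Oct F) := by
  apply ext_coord <;> simp only [Fin.forall_fin_two] <;> refine ⟨⟨?_, ?_⟩, ?_, ?_⟩ <;>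
    simp [cj_fst, cj_snd, one_fst, one_snd, conj_apply, smul_fst, smul_snd, tr, add_fst, add_snd,
      add_comm]

theorem cj_add (u v : Oct F) : cj (u + v) = cj u + cj v := by
  apply Oct.ext
  · simp [cj_fst, add_fst, conj_add]
  · simp [cj_snd, add_snd, add_comm]

theorem cj_smul (c : F) (u : Oct F) : cj (c • u) = c • cj u := by
  apply Oct.ext
  · simp [cj_fst, smul_fst, conj_smul]
  · simp [cj_snd, smul_snd]

theorem cj_cj (u : Oct F) : cj (cj u) = u := by
  apply ext_coord <;> simp only [Fin.forall_fin_two] <;> refine ⟨⟨?_, ?_⟩, ?_, ?_⟩ <;>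
    simp [cj_fst, cj_snd, conj_apply]

theorem cj_mul (u v : Oct F) : cj (u * v) = cj v * cj u := by
  apply ext_coord <;> simp only [Fin.forall_fin_two] <;> refine ⟨⟨?_, ?_⟩, ?_, ?_⟩ <;>
    simp [cj_fst, cj_snd, mul_fst, mul_snd, conj_apply, Matrix.mul_apply, Fin.sum_univ_two] <;> ring

/-- Polarization of `x (x̄ z) = N(x) z`. For orthogonal `x` and `y` it lets factors change places at
the cost of a sign; the product laws of the doubling process rest on this. -/
theorem mul_cj_mul_add (x y z : Oct F) :
    x * (cj y * z) + y * (cj x * z) = bil x y • z := by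
  apply ext_coord <;> simp only [Fin.forall_fin_two] <;> refine ⟨⟨?_, ?_⟩, ?_, ?_⟩ <;>
    simp [bil_eq, cj_fst, cj_snd, mul_fst, mul_snd, conj_apply, Matrix.mul_apply, Fin.sum_univ_two,
      add_fst, add_snd, smul_fst, smul_snd] <;> ring

theorem cj_mul_mul (x z : Oct F) : cj x * (x * z) = norm x • z := by
  apply ext_coord <;> simp only [Fin.forall_fin_two] <;> refine ⟨⟨?_, ?_⟩, ?_, ?_⟩ <;>
    simp [norm_eq, cj_fst, cj_snd, mul_fst, mul_snd, conj_apply, Matrix.mul_apply, Fin.sum_univ_two,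
      smul_fst, smul_snd] <;> ring

theorem mul_mul_self (x z : Oct F) : (x * z) * z = x * (z * z) := by
  apply ext_coord <;> simp only [Fin.forall_fin_two] <;> refine ⟨⟨?_, ?_⟩, ?_, ?_⟩ <;>
    simp [mul_fst, mul_snd, conj_apply, Matrix.mul_apply, Fin.sum_univ_two] <;> ring

theorem mul_self (x : Oct F) : x * x = tr x • x - norm x • (1 : Oct F) := by
  apply ext_coord <;> simp only [Fin.forall_fin_two] <;> refine ⟨⟨?_, ?_⟩, ?_, ?_⟩ <;>
    simp [norm_eq, tr, mul_fst, mul_snd, conj_apply, Matrix.mul_apply, Fin.sum_univ_two,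
      smul_fst, smul_snd, one_fst, one_snd, sub_fst, sub_snd] <;> ring

theorem norm_mul (x y : Oct F) : norm (x * y) = norm x * norm y := by
  simp [norm_eq, mul_fst, mul_snd, conj_apply, Matrix.mul_apply, Fin.sum_univ_two]; ring

theorem bil_mul_left (x y z : Oct F) : bil (x * y) z = bil y (cj x * z) := by
  simp [bil_eq, cj_fst, cj_snd, mul_fst, mul_snd, conj_apply, Matrix.mul_apply, Fin.sum_univ_two]; ring

theorem bil_mul_right (x y z : Oct F) : bil (x * y) z = bil x (z * cj y) := by
  simp [bil_eq, cj_fst, cj_snd, mul_fst, mul_snd, conj_apply, Matrix.mul_apply, Fin.sum_univ_two]; ring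

/-- The polar form as a bilinear map. -/
def bilForm : Oct F →ₗ[F] Oct F →ₗ[F] F :=
  LinearMap.mk₂ F bil bil_add_left (fun c u v => by simp [bil_smul_left]) bil_add_right
    (fun c u v => by simp [bil_smul_right])

@[simp] theorem bilForm_apply (u v : Oct F) : bilForm u v = bil u v := rfl

theorem bil_sub_right (z u v : Oct F) : bil z (u - v) = bil z u - bil z v :=
  (bilForm z).map_sub u v

theorem bil_zero_right (z : Oct F) : bil z 0 = 0 := (bilForm z).map_zero
theorem bil_zero_left (z : Oct F) : bil 0 z = 0 := by rw [bil_comm, bil_zero_right]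

theorem eq_zero_of_bil {x : Oct F} (h : ∀ y, bil x y = 0) : x = 0 := by
  have key : ∀ a b : SplitQuat F, _ = (0 : F) := fun a b => (bil_eq x (a, b)).symm.trans (h (a, b))
  have e1 := key !![1, 0; 0, 0] 0
  have e2 := key !![0, 1; 0, 0] 0
  have e3 := key !![0, 0; 1, 0] 0
  have e4 := key !![0, 0; 0, 1] 0
  have e5 := key 0 !![1, 0; 0, 0]
  have e6 := key 0 !![0, 1; 0, 0]
  have e7 := key 0 !![0, 0; 1, 0]
  have e8 := key 0 !![0, 0; 0, 1]
  simp at e1 e2 e3 e4 e5 e6 e7 e8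
  apply ext_coord <;> simp [Fin.forall_fin_two, zero_fst, zero_snd, *]

/-- The eight matrix entries of an octonion. -/
def coords : Oct F ≃ₗ[F] (Matrix (Fin 2) (Fin 2) F × Matrix (Fin 2) (Fin 2) F) where
  toFun u := u
  invFun u := u
  map_add' _ _ := rfl
  map_smul' _ _ := rfl
  left_inv _ := rfl
  right_inv _ := rfl

instance : Module.Finite F (Oct F) := Module.Finite.equiv (coords (F := F)).symm

instance [Finite F] : Finite (Oct F) := Module.finite_of_finite F

theorem finrank_oct : Module.finrank F (Oct F) = 8 := by
  rw [(coords (F := F)).finrank_eq, Module.finrank_prod, Module.finrank_matrix]; simp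

instance [Finite F] : Finite (Subalg F) := Finite.of_injective _ (SetLike.coe_injective (A := Subalg F))

/-! ### Irreducible quadratics over a finite field -/

/-- The polynomial `x ^ 2 - x + n` has no root. -/
def NoRoot (n : F) : Prop := ∀ r : F, r * (1 - r) ≠ n

theorem exists_noRoot [Finite F] : ∃ n : F, NoRoot n := by
  by_contra! h
  simp only [NoRoot, not_forall, not_not] at h
  have hi : Function.Injective (fun r : F => r * (1 - r)) := Finite.injective_iff_surjective.2 h
  exact zero_ne_one (hi (by simp : (fun r : F => r * (1 - r)) 0 = (fun r : F => r * (1 - r)) 1))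

theorem NoRoot.eq_zero {n a b : F} (hn : NoRoot n) (h : a ^ 2 + a * b + n * b ^ 2 = 0) :
    a = 0 ∧ b = 0 := by
  have hb : b = 0 := by
    by_contra hb
    refine hn (-a / b) ?_
    field_simp
    linear_combination -h
  subst hb
  simpa using h

theorem NoRoot.disc_ne {n : F} (hn : NoRoot n) : 1 - 4 * n ≠ 0 := by
  intro h
  have h2 : (2 : F) ≠ 0 := by
    intro h2
    apply one_ne_zero (α := F)
    linear_combination h + 2 * n * h2
  refine hn 2⁻¹ ?_
  field_simp
  linear_combination h

theorem NoRoot.not_isSquare {n : F} (hn : NoRoot n) (h2 : (2 : F) ≠ 0) :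
    ¬ IsSquare (1 - 4 * n) := by
  rintro ⟨s, hs⟩
  refine hn ((1 - s) / 2) ?_
  field_simp
  linear_combination hs

/-- A non-degenerate binary form over a finite field is universal. In characteristic 2 squares alone
suffice; otherwise completing the square leaves a sum of two quadratic polynomials, which has a root
by the pigeonhole principle. -/
theorem exists_quadratic_eq [Finite F] {m : F} (hm : 1 - 4 * m ≠ 0) (c : F) :
    ∃ a b : F, a ^ 2 + a * b + m * b ^ 2 = c := by
  classical
  have := Fintype.ofFinite F
  by_cases h2 : ringChar F = 2
  · obtain ⟨r, hr⟩ := FiniteField.isSquare_of_char_two h2 c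
    exact ⟨r, 0, by rw [hr]; ring⟩
  · have h2' : (2 : F) ≠ 0 := Ring.two_ne_zero h2
    open Polynomial in
    have hf : degree (X ^ 2 - C c : F[X]) = 2 := degree_X_pow_sub_C (by norm_num) c
    have h0 : (1 - 4 * m) ≠ 0 := hm
    open Polynomial in
    have hg : degree (C (-(1 - 4 * m)) * X ^ 2 : F[X]) = 2 := by
      rw [degree_C_mul_X_pow _ (neg_ne_zero.2 h0)]; rfl
    obtain ⟨a, b, hab⟩ := FiniteField.exists_root_sum_quadratic hf hg
      (FiniteField.odd_card_of_char_ne_two h2)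
    simp at hab
    refine ⟨a - b, 2 * b, ?_⟩
    linear_combination hab

/-- Uniqueness of the quadratic extension in explicit form: `2 * a + b` and `a ^ 2 + a * b + m * b ^
2` are the trace and norm of `a + b u` when `u` has trace 1 and norm `m`. -/
theorem exists_conjugate [Finite F] {m n : F} (hm : NoRoot m) (hn : NoRoot n) :
    ∃ a b : F, 2 * a + b = 1 ∧ a ^ 2 + a * b + m * b ^ 2 = n := by
  classical
  have := Fintype.ofFinite F
  -- Substitute `b = 1 - 2 * a` into the norm equation.
  suffices ∃ a, a * (1 - a) * (1 - 4 * m) = n - m by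
    obtain ⟨a, ha⟩ := this
    exact ⟨a, 1 - 2 * a, by ring, by linear_combination ha⟩
  by_cases h2 : ringChar F = 2
  · have : CharP F 2 := ringChar.of_eq h2
    have h2' : (2 : F) = 0 := CharTwo.two_eq_zero
    -- Artin–Schreier argument: this map is additive in characteristic 2 with kernel `{0, 1}`, so
    -- its image has index 2. As `m` and `n` lie outside the image, their sum lies inside.
    let g : F →+ F :=
      { toFun := fun r => r * (1 - r)
        map_zero' := by simp
        map_add' := fun a b => by linear_combination (- a * b) * h2' }
    have hker : Nat.card g.ker = 2 := by
      have : (g.ker : Set F) = {0, 1} := by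
        ext r
        simp only [SetLike.mem_coe, AddMonoidHom.mem_ker, AddMonoidHom.coe_mk, ZeroHom.coe_mk, g,
          mul_eq_zero, sub_eq_zero, Set.mem_insert_iff, Set.mem_singleton_iff]
        exact or_congr Iff.rfl eq_comm
      rw [← SetLike.coe_sort_coe, this, Nat.card_coe_set_eq, Set.ncard_pair zero_ne_one]
    have hidx : g.range.index = 2 := by
      have h1 := g.range.card_mul_index
      have h3 := g.ker.card_mul_index
      rw [AddSubgroup.index_ker, hker] at h3
      have hpos : 0 < Nat.card g.range := Nat.card_pos
      rw [← h3, mul_comm] at h1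
      exact Nat.eq_of_mul_eq_mul_right hpos h1
    have hm' : m ∉ g.range := fun ⟨r, hr⟩ => hm r hr
    have hn' : n ∉ g.range := fun ⟨r, hr⟩ => hn r hr
    have : n + m ∈ g.range := by
      rw [AddSubgroup.add_mem_iff_of_index_two hidx]; tauto
    obtain ⟨a, ha⟩ := this
    refine ⟨a, ?_⟩
    have ha' : a * (1 - a) = n + m := ha
    linear_combination ha' + (m - 2 * m * (a * (1 - a))) * h2'
  · have h2' : (2 : F) ≠ 0 := Ring.two_ne_zero h2
    have h1 := quadraticChar_neg_one_iff_not_isSquare.2 (hm.not_isSquare h2')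
    have h3 := quadraticChar_neg_one_iff_not_isSquare.2 (hn.not_isSquare h2')
    have hm0 := hm.disc_ne
    -- Both discriminants are non-squares, so their product is a square.
    have h4 : quadraticChar F ((1 - 4 * m) * (1 - 4 * n)) = 1 := by rw [map_mul, h1, h3]; norm_num
    rw [quadraticChar_one_iff_isSquare (mul_ne_zero hm0 hn.disc_ne)] at h4
    obtain ⟨s, hs⟩ := h4
    refine ⟨(1 - s / (1 - 4 * m)) / 2, ?_⟩
    field_simp
    linear_combination hs

/-! ### Counting solutions of `x * y = g r` -/

theorem card_subtype_prod {α β : Type*} [Fintype α] [Finite β] (P : α × β → Prop) :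
    Nat.card {p : α × β // P p} = ∑ a, Nat.card {b : β // P (a, b)} := by
  classical
  have := Fintype.ofFinite β
  have e : {p : α × β // P p} ≃ Σ a, {b : β // P (a, b)} :=
    { toFun := fun p => ⟨p.1.1, p.1.2, p.2⟩
      invFun := fun p => ⟨(p.1, p.2.1), p.2.2⟩
      left_inv := fun _ => rfl
      right_inv := fun _ => rfl }
  rw [Nat.card_congr e, Nat.card_sigma]

/-- The number of solutions of `x * y = g r`. -/
theorem card_mul_eq [Finite F] {R : Type*} [Finite R] (g : R → F) :
    Nat.card {p : F × F × R // p.1 * p.2.1 = g p.2.2} =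
      Nat.card F * Nat.card {r // g r = 0} + (Nat.card F - 1) * Nat.card R := by
  classical
  -- For `x = 0` the equation forces `g r = 0` and leaves `y` free; for each `x ≠ 0` it determines
  -- `y` from `r`.
  have := Fintype.ofFinite F
  rw [card_subtype_prod, ← Finset.add_sum_erase _ _ (Finset.mem_univ (0 : F))]
  congr 1
  · rw [← Nat.card_prod]
    refine Nat.card_congr ⟨fun p => ⟨p.1.1, p.1.2, by simpa using p.2.symm⟩,
      fun p => ⟨(p.1, p.2.1), by simpa using p.2.2.symm⟩, fun _ => rfl, fun _ => rfl⟩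
  · rw [Finset.sum_congr rfl (g := fun _ => Nat.card R), Finset.sum_const, smul_eq_mul,
      Finset.card_erase_of_mem (Finset.mem_univ _), Finset.card_univ,
      Nat.card_eq_fintype_card (α := F)]
    intro x hx
    have hx0 : x ≠ 0 := Finset.ne_of_mem_erase hx
    refine Nat.card_congr ⟨fun p => p.1.2, fun r => ⟨(x⁻¹ * g r, r), by field_simp⟩, ?_,
      fun _ => rfl⟩
    rintro ⟨⟨y, r⟩, h⟩
    simp only [Subtype.mk.injEq, Prod.mk.injEq, and_true]
    rw [← h]; field_simp

/-! ### The Cayley–Dickson doubling process -/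

theorem cj_of_tr {w : Oct F} (h : bil 1 w = 0) : cj w = -w := by
  have := add_cj w
  rw [bil_one_left] at h
  rw [h, zero_smul] at this
  exact (neg_eq_of_add_eq_zero_right this).symm

theorem cj_eq (a : Oct F) : cj a = tr a • (1 : Oct F) - a := by
  rw [← add_cj]; abel

theorem bil_cj {a w : Oct F} (h1 : bil 1 w = 0) (ha : bil a w = 0) : bil (cj a) w = 0 := by
  rw [cj_eq, bil_comm, bil_sub_right, bil_smul_right, bil_comm w, bil_comm w, h1, ha]; ring

theorem mul_cj_of_bil {a w : Oct F} (h1 : bil 1 w = 0) (ha : bil a w = 0) :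
    cj (a * w) = -(a * w) := by
  apply cj_of_tr
  rw [bil_comm, bil_mul_left, mul_one, bil_comm]
  exact bil_cj h1 ha

/-- The product `a * w` has trace zero, hence is negated by conjugation; expanding its conjugate
gives the rule. -/
theorem mul_comm_of_bil {a w : Oct F} (h1 : bil 1 w = 0) (ha : bil a w = 0) :
    a * w = w * cj a := by
  have := mul_cj_of_bil h1 ha
  rw [cj_mul, cj_of_tr h1, neg_mul, neg_inj] at this
  exact this.symm

theorem mul_mul_of_bil {a b w : Oct F} (h1 : bil 1 w = 0) (ha : bil a w = 0) (hb : bil b w = 0)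
    (hba : bil (b * a) w = 0) : a * (b * w) = (b * a) * w := by
  -- Orthogonality of `a` and `w` kills the right-hand side, leaving `a (w̄ b̄) + w (ā b̄) = 0`.
  have h := mul_cj_mul_add a w (cj b)
  rw [ha, zero_smul, cj_of_tr h1, neg_mul, mul_neg, neg_add_eq_zero, ← cj_mul,
    ← mul_comm_of_bil h1 hb, ← mul_comm_of_bil h1 hba] at h
  exact h

theorem mul_mul_of_bil' {a b w : Oct F} (h1 : bil 1 w = 0) (ha : bil a w = 0) (hb : bil b w = 0)
    (hab : bil (a * cj b) w = 0) : (a * w) * b = (a * cj b) * w := by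
  rw [← cj_cj ((a * w) * b), cj_mul, mul_cj_of_bil h1 ha, mul_neg,
    mul_mul_of_bil h1 (bil_cj h1 hb) ha hab, ← mul_cj_of_bil h1 hab, cj_cj]

theorem mul_mul_mul_of_bil {a b w : Oct F} (h1 : bil 1 w = 0) (ha : bil a w = 0)
    (hba : bil (b * a) w = 0) : (a * w) * (b * w) = -(norm w • (cj b * a)) := by
  -- Here `a * w` is orthogonal to `cj b`, and `(a * w) * w = a * (w * w)` with `w * w` the scalar
  -- `-norm w`.
  have h := mul_cj_mul_add (a * w) (cj b) w
  have hp : bil (a * w) (cj b) = 0 := by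
    rw [bil_mul_left, ← cj_mul, bil_comm]; exact bil_cj h1 hba
  have hw : w * w = -(norm w • (1 : Oct F)) := by
    rw [mul_self, ← bil_one_left, h1]; simp
  rw [hp, zero_smul, cj_cj, mul_cj_of_bil h1 ha, neg_mul, mul_mul_self, hw] at h
  simp only [mul_neg, neg_neg, mul_smul_comm, mul_one] at h
  exact eq_neg_of_add_eq_zero_left h

theorem bil_mul_mul (x y z : Oct F) : bil (x * z) (y * z) = norm z * bil x y := by
  simp only [bil, QuadraticMap.polar, ← add_mul, norm_mul]; ring

/-- A linear map into `𝕆` that is multiplicative and compatible with the involution for given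
operations on the source, and whose range contains `1`. -/
structure IsEmb {S : Type*} [AddCommGroup S] [Module F S] (m : S → S → S) (s : S → S)
    (f : S →ₗ[F] Oct F) : Prop where
  one : ∃ e, f e = 1
  map_mul : ∀ x y, f (m x y) = f x * f y
  map_cj : ∀ x, f (s x) = cj (f x)

/-- The polar form is non-degenerate along `f`. -/
def Nondeg {S : Type*} [AddCommGroup S] [Module F S] (f : S →ₗ[F] Oct F) : Prop :=
  ∀ x, (∀ y, bil (f x) (f y) = 0) → x = 0

/-- The doubling `x + y w` of a linear map. -/
def double {S : Type*} [AddCommGroup S] [Module F S] (f : S →ₗ[F] Oct F) (w : Oct F) :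
    S × S →ₗ[F] Oct F :=
  f.coprod (LinearMap.mulRight F w ∘ₗ f)

/-- The multiplication of the double. -/
def dmul {S : Type*} [AddCommGroup S] [Module F S] (c : F) (m : S → S → S) (s : S → S)
    (x y : S × S) : S × S :=
  (m x.1 y.1 - c • m (s y.2) x.2, m y.2 x.1 + m x.2 (s y.1))

/-- The involution of the double. -/
def dcj {S : Type*} [AddCommGroup S] (s : S → S) (x : S × S) : S × S := (s x.1, -x.2)

section

variable {S : Type*} [AddCommGroup S] [Module F S] {m : S → S → S} {s : S → S}
  {f : S →ₗ[F] Oct F} {w : Oct F}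

theorem double_apply (f : S →ₗ[F] Oct F) (w : Oct F) (x : S × S) :
    double f w x = f x.1 + f x.2 * w := by
  simp [double]

theorem IsEmb.bil_one (hf : IsEmb m s f) (hw : ∀ x, bil (f x) w = 0) : bil 1 w = 0 := by
  obtain ⟨e, he⟩ := hf.one
  rw [← he]; exact hw e

theorem IsEmb.bil_mul (hf : IsEmb m s f) (hw : ∀ x, bil (f x) w = 0) (x y : S) :
    bil (f x * f y) w = 0 := by
  rw [← hf.map_mul]; exact hw _

theorem IsEmb.bil_mul_right (hf : IsEmb m s f) (hw : ∀ x, bil (f x) w = 0) (x y : S) :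
    bil (f x) (f y * w) = 0 := by
  rw [bil_comm, bil_mul_left, bil_comm, ← hf.map_cj]; exact hf.bil_mul hw _ _

/-- The three preceding product laws give the four products in `(a + b w) (c + d w)`. Only `norm w`
enters `dmul`, so different choices of `w` with the same norm have the same multiplication table. -/
theorem IsEmb.double (hf : IsEmb m s f) (hw : ∀ x, bil (f x) w = 0) :
    IsEmb (dmul (norm w) m s) (dcj s) (double f w) := by
  have h1 := hf.bil_one hw
  refine ⟨?_, ?_, ?_⟩
  · obtain ⟨e, he⟩ := hf.one
    exact ⟨(e, 0), by simp [double_apply, he]⟩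
  · rintro ⟨a, b⟩ ⟨c, d⟩
    simp only [double_apply, dmul, map_sub, map_add, map_smul, hf.map_mul, hf.map_cj]
    rw [add_mul (f a), mul_add (f a), mul_add (f b * w),
      mul_mul_of_bil h1 (hw a) (hw d) (hf.bil_mul hw _ _),
      mul_mul_of_bil' h1 (hw b) (hw c) (by rw [← hf.map_cj]; exact hf.bil_mul hw _ _),
      mul_mul_mul_of_bil h1 (hw b) (hf.bil_mul hw _ _), add_mul]
    abel
  · rintro ⟨a, b⟩
    simp only [double_apply, dcj, hf.map_cj, cj_add, map_neg, mul_cj_of_bil h1 (hw b), neg_mul]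

theorem IsEmb.bil_double (hf : IsEmb m s f) (hw : ∀ x, bil (f x) w = 0) (x y : S × S) :
    bil (Oct.double f w x) (Oct.double f w y) =
      bil (f x.1) (f y.1) + norm w * bil (f x.2) (f y.2) := by
  simp only [double_apply, bil_add_left, bil_add_right, bil_mul_mul, hf.bil_mul_right hw]
  rw [bil_comm (f x.2 * w), hf.bil_mul_right hw]; ring

theorem IsEmb.norm_double (hf : IsEmb m s f) (hw : ∀ x, bil (f x) w = 0) (x : S × S) :
    norm (Oct.double f w x) = norm (f x.1) + norm (f x.2) * norm w := by
  rw [double_apply, norm_add, hf.bil_mul_right hw, norm_mul, add_zero]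

theorem Nondeg.double (hn : Nondeg f) (hf : IsEmb m s f) (hw : ∀ x, bil (f x) w = 0)
    (hw0 : norm w ≠ 0) : Nondeg (Oct.double f w) := by
  rintro ⟨a, b⟩ h
  have ha : a = 0 := hn a fun y => by
    have := h (y, 0)
    simpa [hf.bil_double hw, bil_zero_right] using this
  have hb : b = 0 := hn b fun y => by
    have := h (0, y)
    simpa [hf.bil_double hw, bil_zero_right, hw0] using this
  rw [ha, hb]; rfl

theorem Nondeg.injective (hn : Nondeg f) : Function.Injective f := by
  rw [injective_iff_map_eq_zero]
  exact fun x hx => hn x fun y => by rw [hx, bil_zero_left]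

/-- Orthogonal projection onto the range of `f`: non-degeneracy embeds `S` in its dual, and equality
of dimensions makes this map surjective. -/
theorem Nondeg.exists_proj [Module.Finite F S] (hn : Nondeg f) (x : Oct F) :
    ∃ a, ∀ y, bil (f y) (x - f a) = 0 := by
  let g : S →ₗ[F] Module.Dual F S := (bilForm.compl₁₂ f f)
  have hg : Function.Injective g := by
    rw [injective_iff_map_eq_zero]
    exact fun a ha => hn a fun y => LinearMap.congr_fun ha y
  have hs : Function.Surjective g :=
    (LinearMap.injective_iff_surjective_of_finrank_eq_finrank Subspace.dual_finrank_eq.symm).1 hg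
  obtain ⟨a, ha⟩ := hs (bilForm x ∘ₗ f)
  refine ⟨a, fun y => ?_⟩
  have : bil (f a) (f y) = bil x (f y) := LinearMap.congr_fun ha y
  rw [bil_sub_right, bil_comm _ x, bil_comm _ (f a), this, sub_self]

/-- A non-degenerate subspace strictly containing the range of `f` contains an anisotropic vector
orthogonal to `f`. -/
theorem Nondeg.exists_perp [Module.Finite F S] (hn : Nondeg f) (W : Submodule F (Oct F))
    (hW : ∀ x ∈ W, (∀ y ∈ W, bil x y = 0) → x = 0) (hf : ∀ a, f a ∈ W)
    (hx : ∃ x ∈ W, ∀ a, f a ≠ x) : ∃ w ∈ W, (∀ a, bil (f a) w = 0) ∧ norm w ≠ 0 := by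
  obtain ⟨x, hxW, hx⟩ := hx
  obtain ⟨a, ha⟩ := hn.exists_proj x
  have hy : x - f a ≠ 0 := fun h => hx a (sub_eq_zero.1 h).symm
  have hyW : x - f a ∈ W := W.sub_mem hxW (hf a)
  set y := x - f a
  obtain ⟨v, hvW, hv⟩ : ∃ v ∈ W, bil y v ≠ 0 := by
    by_contra! h
    exact hy (hW y hyW h)
  obtain ⟨b, hb⟩ := hn.exists_proj v
  have hv' : bil y (v - f b) ≠ 0 := by
    rwa [bil_sub_right, bil_comm y (f b), ha, sub_zero]
  have hvW' : v - f b ∈ W := W.sub_mem hvW (hf b)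
  -- Among `y`, `v - f b` and their sum one is anisotropic: if the first two are isotropic, the sum
  -- has norm `bil y (v - f b) ≠ 0`.
  by_cases h1 : norm y = 0
  · by_cases h2 : norm (v - f b) = 0
    · refine ⟨y + (v - f b), W.add_mem hyW hvW', fun c => ?_, ?_⟩
      · rw [bil_add_right, ha, hb, add_zero]
      · rw [norm_add, h1, h2]; simpa using hv'
    · exact ⟨_, hvW', hb, h2⟩
  · exact ⟨y, hyW, ha, h1⟩

/-- The subalgebra that is the range of a multiplicative map. -/
def IsEmb.range (hf : IsEmb m s f) : Subalg F :=
  { LinearMap.range f with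
    mul_mem' := by
      rintro _ _ ⟨x, rfl⟩ ⟨y, rfl⟩
      exact ⟨m x y, hf.map_mul x y⟩ }

/-- In dimension 8 both maps are bijections onto `𝕆` that transport the same product `m`, so `f' ∘
f⁻¹` is an automorphism. -/
theorem IsEmb.exists_aut [Module.Finite F S] {f' : S →ₗ[F] Oct F} (hf : IsEmb m s f)
    (hf' : IsEmb m s f') (hn : Nondeg f) (hn' : Nondeg f') (h8 : Module.finrank F S = 8) :
    ∃ α : Aut F, ∀ x, α.1 (f x) = f' x := by
  let e := LinearEquiv.ofInjectiveOfFinrankEq f hn.injective (h8.trans finrank_oct.symm)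
  let e' := LinearEquiv.ofInjectiveOfFinrankEq f' hn'.injective (h8.trans finrank_oct.symm)
  have h : ∀ x, (e.symm.trans e') (f x) = f' x := fun x => by
    have : e.symm (f x) = x := e.symm_apply_apply x
    rw [LinearEquiv.trans_apply, this]; rfl
  refine ⟨⟨e.symm.trans e', fun u v => ?_⟩, h⟩
  obtain ⟨x, rfl⟩ := e.surjective u
  obtain ⟨y, rfl⟩ := e.surjective v
  change (e.symm.trans e') (f x * f y) = (e.symm.trans e') (f x) * (e.symm.trans e') (f y)
  rw [← hf.map_mul, h, h, h, hf'.map_mul]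

end

/-! ### The algebras `F[u]` and `F[u] + F[u]z` -/

/-- The linear map `(a, b) ↦ a + b u`. -/
def lineMap (u : Oct F) : F × F →ₗ[F] Oct F :=
  (LinearMap.toSpanSingleton F (Oct F) 1).coprod (LinearMap.toSpanSingleton F (Oct F) u)

theorem lineMap_apply (u : Oct F) (p : F × F) : lineMap u p = p.1 • (1 : Oct F) + p.2 • u := by
  simp [lineMap]

/-- The multiplication of `F[u]` for `u` of trace `1` and norm `n`. -/
def lmul (n : F) (p r : F × F) : F × F :=
  (p.1 * r.1 - n * (p.2 * r.2), p.1 * r.2 + p.2 * r.1 + p.2 * r.2)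

/-- The involution of `F[u]` for `u` of trace `1`. -/
def lcj (p : F × F) : F × F := (p.1 + p.2, -p.2)

theorem isEmb_lineMap {u : Oct F} (hu : tr u = 1) : IsEmb (lmul (norm u)) lcj (lineMap u) := by
  refine ⟨⟨(1, 0), by simp [lineMap_apply]⟩, fun p r => ?_, fun p => ?_⟩
  · have := mul_self u
    rw [hu, one_smul] at this
    simp only [lineMap_apply, lmul, add_mul, mul_add, smul_mul_assoc, mul_smul_comm, one_mul,
      mul_one, this]
    module
  · simp only [lineMap_apply, lcj, cj_add, cj_smul, cj_one, cj_eq u, hu]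
    module

theorem bil_lineMap (u z : Oct F) (p : F × F) :
    bil (lineMap u p) z = p.1 * bil 1 z + p.2 * bil u z := by
  simp only [lineMap_apply, bil_add_left, bil_smul_left]

theorem bil_lineMap_eq_zero {u z : Oct F} :
    (∀ p, bil (lineMap u p) z = 0) ↔ bil 1 z = 0 ∧ bil u z = 0 := by
  simp only [bil_lineMap]
  refine ⟨fun h => ⟨by simpa using h (1, 0), by simpa using h (0, 1)⟩, fun h p => ?_⟩
  rw [h.1, h.2]; ring

theorem norm_lineMap {u : Oct F} (hu : tr u = 1) (p : F × F) :
    norm (lineMap u p) = p.1 ^ 2 + p.1 * p.2 + norm u * p.2 ^ 2 := by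
  rw [lineMap_apply, norm_add, norm_smul, norm_smul, bil_smul_left, bil_smul_right, bil_one_left,
    hu, norm_one]
  ring

theorem tr_add (x y : Oct F) : tr (x + y) = tr x + tr y := by
  simp only [← bil_one_left, bil_add_right]

theorem tr_smul (c : F) (x : Oct F) : tr (c • x) = c * tr x := by
  simp only [← bil_one_left, bil_smul_right]

theorem tr_one : tr (1 : Oct F) = 2 := by
  rw [← bil_one_left, bil_self, norm_one, mul_one]

theorem tr_lineMap {u : Oct F} (hu : tr u = 1) (p : F × F) :
    tr (lineMap u p) = 2 * p.1 + p.2 := by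
  rw [lineMap_apply, tr_add, tr_smul, tr_smul, hu, tr_one]; ring

/-- The Gram determinant of `1, u` is `4 * norm u - 1`. -/
theorem nondeg_lineMap {u : Oct F} (hu : tr u = 1) (h : 1 - 4 * norm u ≠ 0) :
    Nondeg (lineMap u) := by
  intro p hp
  have h1 := hp (1, 0)
  have h2 := hp (0, 1)
  rw [bil_lineMap] at h1 h2
  simp only [lineMap_apply, one_smul, zero_smul, add_zero, zero_add, bil_self, norm_one,
    bil_one_left, bil_comm u 1, hu] at h1 h2
  have hb : p.2 = 0 := by
    have : (1 - 4 * norm u) * p.2 = 0 := by linear_combination h1 - 2 * h2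
    exact (mul_eq_zero.1 this).resolve_left h
  refine Prod.ext ?_ hb
  rw [hb] at h2
  simpa using h2

theorem norm_lineMap_eq_zero {u : Oct F} (hu : tr u = 1) (hn : NoRoot (norm u)) {p : F × F}
    (h : norm (lineMap u p) = 0) : p = 0 := by
  rw [norm_lineMap hu] at h
  exact Prod.ext (hn.eq_zero h).1 (hn.eq_zero h).2

/-- The linear map `(a, b) ↦ a + b z` with `a` and `b` in `F[u]`. -/
def quadMap (u z : Oct F) : (F × F) × (F × F) →ₗ[F] Oct F := double (lineMap u) z

theorem quadMap_apply (u z : Oct F) (p : (F × F) × (F × F)) :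
    quadMap u z p = lineMap u p.1 + lineMap u p.2 * z := double_apply _ _ _

theorem isEmb_quadMap {u z : Oct F} (hu : tr u = 1) (h1 : bil 1 z = 0) (h2 : bil u z = 0) :
    IsEmb (dmul (norm z) (lmul (norm u)) lcj) (dcj lcj) (quadMap u z) :=
  (isEmb_lineMap hu).double (bil_lineMap_eq_zero.2 ⟨h1, h2⟩)

theorem nondeg_quadMap {u z : Oct F} (hu : tr u = 1) (h : 1 - 4 * norm u ≠ 0) (h1 : bil 1 z = 0)
    (h2 : bil u z = 0) (hz : norm z ≠ 0) : Nondeg (quadMap u z) :=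
  (nondeg_lineMap hu h).double (isEmb_lineMap hu) (bil_lineMap_eq_zero.2 ⟨h1, h2⟩) hz

theorem lineMap_injective {u : Oct F} (hu : tr u = 1) (hn : NoRoot (norm u)) :
    Function.Injective (lineMap u) :=
  (nondeg_lineMap hu hn.disc_ne).injective

theorem lineMap_mul_injective {u z : Oct F} (hu : tr u = 1) (hn : NoRoot (norm u)) (hz : z ≠ 0) :
    Function.Injective (fun p => lineMap u p * z) := by
  change Function.Injective (LinearMap.mulRight F z ∘ₗ lineMap u)
  rw [injective_iff_map_eq_zero]
  intro p hp
  apply norm_lineMap_eq_zero hu hn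
  have hp : lineMap u p * z = 0 := hp
  have := cj_mul_mul (lineMap u p) z
  rw [hp, mul_zero] at this
  exact (smul_eq_zero.1 this.symm).resolve_right hz

/-- Covers isotropic `z`, where the double is degenerate: pairing with `F[u]` kills the first
component, and on `F[u]z` injectivity follows from `x̄ (x z) = N(x) z`. -/
theorem quadMap_injective {u z : Oct F} (hu : tr u = 1) (hn : NoRoot (norm u)) (h1 : bil 1 z = 0)
    (h2 : bil u z = 0) (hz : z ≠ 0) : Function.Injective (quadMap u z) := by
  rw [injective_iff_map_eq_zero]
  rintro ⟨a, b⟩ h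
  have hf := isEmb_lineMap hu
  have hp := bil_lineMap_eq_zero.2 ⟨h1, h2⟩
  have ha : a = 0 := nondeg_lineMap hu hn.disc_ne a fun y => by
    have := hf.bil_double hp (a, b) (y, 0)
    rw [← quadMap, h, bil_zero_left, map_zero, bil_zero_right] at this
    simpa using this.symm
  subst ha
  rw [quadMap_apply, map_zero, zero_add] at h
  have hb : b = 0 := lineMap_mul_injective hu hn hz (h.trans (by simp))
  rw [hb]; rfl

theorem coe_eq_range_of_finrank {S : Type*} [AddCommGroup S] [Module F S] {f : S →ₗ[F] Oct F}
    (D : Subalg F) (hf : Function.Injective f) (hD : ∀ p, f p ∈ D)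
    (h : Module.finrank F D.toSubmodule = Module.finrank F S) :
    (D : Set (Oct F)) = Set.range f := by
  have hle : LinearMap.range f ≤ D.toSubmodule := by
    rintro _ ⟨p, rfl⟩; exact hD p
  have := Submodule.eq_of_le_of_finrank_eq hle (by rw [LinearMap.finrank_range_of_inj hf, h])
  ext x
  exact (SetLike.ext_iff.1 this x).symm

theorem finrank_eq_of_coe_eq_range {S : Type*} [AddCommGroup S] [Module F S] {f : S →ₗ[F] Oct F}
    (D : Subalg F) (hf : Function.Injective f) (h : (D : Set (Oct F)) = Set.range f) :
    Module.finrank F D.toSubmodule = Module.finrank F S := by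
  have : D.toSubmodule = LinearMap.range f := SetLike.coe_injective h
  rw [this, LinearMap.finrank_range_of_inj hf]

theorem finrank_line : Module.finrank F (F × F) = 2 := by simp
theorem finrank_quad : Module.finrank F ((F × F) × (F × F)) = 4 := by simp

/-! ### Normal forms for `setD`, `setX` and `setH` -/

theorem noRoot_norm {v : Oct F} (hv : tr v = 1)
    (h : ∀ p : F × F, norm (lineMap v p) = 0 → lineMap v p = 0) (hs : ∀ c : F, c • (1 : Oct F) ≠ v) :
    NoRoot (norm v) := by
  intro r hr
  have := h (-r, 1) (by rw [norm_lineMap hv, ← hr]; ring)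
  rw [lineMap_apply, neg_smul, one_smul, neg_add_eq_zero] at this
  exact hs r this

/-- Serves to replace a scalar `v` of trace 1 (such as `1/2`) by a non-scalar element, adding the
trace-zero element `w - tr w • v`. -/
theorem smul_one_add_ne {v : Oct F} {c t : F} {w : Oct F} (hv : c • (1 : Oct F) = v)
    (hw : ∀ d : F, d • (1 : Oct F) ≠ w) (d : F) : d • (1 : Oct F) ≠ v + (w - t • v) := by
  subst hv
  intro h
  refine hw (d - c + t * c) ?_
  rw [add_smul, sub_smul, h, mul_smul]; abel

theorem mem_setD_iff [Finite F] {n : F} (hn : NoRoot n) (D : Subalg F) : D ∈ setD F ↔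
    ∃ u, tr u = 1 ∧ norm u = n ∧ (D : Set (Oct F)) = Set.range (lineMap u) := by
  constructor
  · rintro ⟨h2, han, x, hx, y, hy, hxy⟩
    -- The equation `x * x = tr x • x - norm x • 1` puts `norm x • 1` into `D`, and `norm x ≠ 0` by
    -- anisotropy.
    have one_mem : (1 : Oct F) ∈ D := by
      have hx0 : x ≠ 0 := by rintro rfl; exact hxy (bil_zero_left y)
      have hN : norm x ≠ 0 := fun h => hx0 (han x hx h)
      have h1 : norm x • (1 : Oct F) ∈ D := by
        have : norm x • (1 : Oct F) = tr x • x - x * x := by rw [mul_self]; abel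
        rw [this]
        exact sub_mem (SMulMemClass.smul_mem _ hx) (mul_mem hx hx)
      have := SMulMemClass.smul_mem (norm x)⁻¹ h1
      rwa [smul_smul, inv_mul_cancel₀ hN, one_smul] at this
    have hmem : ∀ u ∈ D, ∀ p, lineMap u p ∈ D := fun u hu p => by
      rw [lineMap_apply]
      exact add_mem (SMulMemClass.smul_mem _ one_mem) (SMulMemClass.smul_mem _ hu)
    obtain ⟨v, hv, hv1⟩ : ∃ v ∈ D, tr v = 1 := by
      have ht : tr (cj x * y) = bil x y := by
        rw [← bil_one_left, bil_comm, bil_mul_left, cj_cj, mul_one, bil_comm]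
      refine ⟨(bil x y)⁻¹ • (cj x * y), SMulMemClass.smul_mem _ (mul_mem ?_ hy), ?_⟩
      · rw [cj_eq]
        exact sub_mem (SMulMemClass.smul_mem _ one_mem) hx
      · rw [tr_smul, ht, inv_mul_cancel₀ hxy]
    obtain ⟨w, hw, hws⟩ : ∃ w ∈ D, ∀ c : F, c • (1 : Oct F) ≠ w := by
      by_contra! h
      have hle : D.toSubmodule ≤ Submodule.span F {(1 : Oct F)} := fun w hw =>
        Submodule.mem_span_singleton.2 (h w hw)
      have h3 := Submodule.finrank_mono hle
      have h4 := finrank_span_le_card (R := F) ({(1 : Oct F)} : Set (Oct F))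
      simp at h4
      omega
    obtain ⟨v, hv, hv1, hvs⟩ : ∃ v ∈ D, tr v = 1 ∧ ∀ c : F, c • (1 : Oct F) ≠ v := by
      by_cases hvs : ∃ c : F, c • (1 : Oct F) = v
      · obtain ⟨c, hc⟩ := hvs
        refine ⟨v + (w - tr w • v), add_mem hv (sub_mem hw (SMulMemClass.smul_mem _ hv)), ?_,
          smul_one_add_ne hc hws⟩
        rw [← bil_one_left, bil_add_right, bil_sub_right, bil_smul_right, bil_one_left,
          bil_one_left, hv1]
        ring
      · exact ⟨v, hv, hv1, by simpa using hvs⟩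
    have hvn := noRoot_norm hv1 (fun p => han _ (hmem v hv p)) hvs
    obtain ⟨a, b, hab, hn'⟩ := exists_conjugate hvn hn
    have ht : tr (lineMap v (a, b)) = 1 := by rw [tr_lineMap hv1, hab]
    have hN : norm (lineMap v (a, b)) = n := by rw [norm_lineMap hv1, hn']
    refine ⟨lineMap v (a, b), ht, hN, coe_eq_range_of_finrank D (lineMap_injective ht (hN ▸ hn))
      (hmem _ (hmem v hv _)) (h2.trans finrank_line.symm)⟩
  · rintro ⟨u, hu, rfl, hD⟩
    have hmem : ∀ x, x ∈ D ↔ ∃ p, lineMap u p = x := fun x => Set.ext_iff.1 hD x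
    refine ⟨(finrank_eq_of_coe_eq_range D (lineMap_injective hu hn) hD).trans finrank_line, ?_,
      1, (hmem 1).2 ⟨(1, 0), by simp [lineMap_apply]⟩, u,
      (hmem u).2 ⟨(0, 1), by simp [lineMap_apply]⟩, by simp [bil_one_left, hu]⟩
    intro x hx h
    obtain ⟨p, rfl⟩ := (hmem x).1 hx
    rw [norm_lineMap_eq_zero hu hn h, map_zero]

theorem mul_self_eq_zero_iff {z : Oct F} (h1 : bil 1 z = 0) : z * z = 0 ↔ norm z = 0 := by
  rw [mul_self, ← bil_one_left, h1, zero_smul, zero_sub, neg_eq_zero, smul_eq_zero]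
  refine or_iff_left fun h => one_ne_zero (α := F) ?_
  rw [← norm_one (F := F), h, norm_zero]

theorem mem_setX_iff [Finite F] {n : F} (hn : NoRoot n) (X : Subalg F) : X ∈ setX F ↔
    ∃ u z, tr u = 1 ∧ norm u = n ∧ bil 1 z = 0 ∧ bil u z = 0 ∧ norm z = 0 ∧ z ≠ 0 ∧
      (X : Set (Oct F)) = Set.range (quadMap u z) := by
  constructor
  · rintro ⟨D, hD, z, hz, hzz, hz0, hX⟩
    obtain ⟨u, hu, hun, hDu⟩ := (mem_setD_iff hn D).1 hD
    have hmem : ∀ x, x ∈ D ↔ ∃ p, lineMap u p = x := fun x => Set.ext_iff.1 hDu x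
    obtain ⟨h1, h2⟩ := bil_lineMap_eq_zero.1 fun p => hz _ ((hmem _).2 ⟨p, rfl⟩)
    refine ⟨u, z, hu, hun, h1, h2, (mul_self_eq_zero_iff h1).1 hzz, hz0, ?_⟩
    rw [hX]
    ext x
    constructor
    · rintro ⟨a, ha, b, hb, rfl⟩
      obtain ⟨p, rfl⟩ := (hmem a).1 ha
      obtain ⟨r, rfl⟩ := (hmem b).1 hb
      exact ⟨(p, r), quadMap_apply _ _ _⟩
    · rintro ⟨p, rfl⟩
      exact ⟨_, (hmem _).2 ⟨p.1, rfl⟩, _, (hmem _).2 ⟨p.2, rfl⟩, quadMap_apply _ _ _⟩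
  · rintro ⟨u, z, hu, hun, h1, h2, hz, hz0, hX⟩
    refine ⟨(isEmb_lineMap hu).range, (mem_setD_iff hn _).2 ⟨u, hu, hun, rfl⟩, z, ?_,
      (mul_self_eq_zero_iff h1).2 hz, hz0, ?_⟩
    · rintro _ ⟨p, rfl⟩
      exact bil_lineMap_eq_zero.2 ⟨h1, h2⟩ p
    · rw [hX]
      ext x
      constructor
      · rintro ⟨p, rfl⟩
        exact ⟨_, ⟨p.1, rfl⟩, _, ⟨p.2, rfl⟩, quadMap_apply _ _ _⟩
      · rintro ⟨_, ⟨p, rfl⟩, _, ⟨r, rfl⟩, rfl⟩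
        exact ⟨(p, r), quadMap_apply _ _ _⟩

/-- Non-degeneracy of `H` yields an anisotropic `y` orthogonal to `F[u]`, and a dimension count
finishes. Only separability of `x ^ 2 - x + norm u` is assumed, so that this applies before the norm
of `u` has been normalized. -/
theorem exists_range_quadMap {H : Subalg F} (hH : H ∈ setH F) {u : Oct F} (hu : tr u = 1)
    (hd : 1 - 4 * norm u ≠ 0) (huH : u ∈ H) :
    ∃ y, bil 1 y = 0 ∧ bil u y = 0 ∧ norm y ≠ 0 ∧ (H : Set (Oct F)) = Set.range (quadMap u y) := by
  obtain ⟨h1, h4, hnd⟩ := hH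
  have hmem : ∀ p, lineMap u p ∈ H := fun p => by
    rw [lineMap_apply]
    exact add_mem (SMulMemClass.smul_mem _ h1) (SMulMemClass.smul_mem _ huH)
  have hx : ∃ x ∈ H.toSubmodule, ∀ a, lineMap u a ≠ x := by
    by_contra! h
    have hle : H.toSubmodule ≤ LinearMap.range (lineMap u) := h
    have h3 := Submodule.finrank_mono hle
    have h5 := LinearMap.finrank_range_le (lineMap u)
    rw [finrank_line] at h5
    omega
  obtain ⟨y, hy, hp, hy0⟩ := (nondeg_lineMap hu hd).exists_perp H.toSubmodule hnd hmem hx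
  obtain ⟨hy1, hy2⟩ := bil_lineMap_eq_zero.1 hp
  refine ⟨y, hy1, hy2, hy0, coe_eq_range_of_finrank H
    (nondeg_quadMap hu hd hy1 hy2 hy0).injective (fun p => ?_) (h4.trans finrank_quad.symm)⟩
  rw [quadMap_apply]
  exact add_mem (hmem _) (mul_mem (hmem _) hy)

/-- Start with `v` in `H` of trace 1 and non-zero discriminant and write `H = F[v] + F[v]y`. Adding
an element of `F[v]y` keeps the trace, and universality of the norm form adjusts the norm to `n`. -/
theorem exists_mem_setH_tr [Finite F] {n : F} {H : Subalg F} (hH : H ∈ setH F) :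
    ∃ u ∈ H, tr u = 1 ∧ norm u = n := by
  obtain ⟨v, hv, hv1, hd⟩ : ∃ v ∈ H, tr v = 1 ∧ 1 - 4 * norm v ≠ 0 := by
    obtain ⟨h1, h4, hnd⟩ := hH
    by_cases h2 : (2 : F) = 0
    · obtain ⟨x, hx, hx1⟩ : ∃ x ∈ H, bil 1 x ≠ 0 := by
        by_contra! h
        have := hnd 1 h1 h
        have h3 := norm_one (F := F)
        rw [this, norm_zero] at h3
        exact zero_ne_one h3
      refine ⟨(bil 1 x)⁻¹ • x, SMulMemClass.smul_mem _ hx, ?_, ?_⟩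
      · rw [tr_smul, ← bil_one_left, inv_mul_cancel₀ hx1]
      · have : (4 : F) = 2 * 2 := by norm_num
        simp [this, h2]
    · by_contra! h
      -- In odd characteristic `1/2 + k` has trace 1 and discriminant `-4 * norm k`. If all
      -- discriminants vanish, the trace-zero part is totally isotropic, hence in the radical, hence
      -- zero, and `H` would be one-dimensional.
      have key : ∀ k ∈ H, tr k = 0 → norm k = 0 := fun k hk hk0 => by
        have h3 := h ((2 : F)⁻¹ • (1 : Oct F) + k) (add_mem (SMulMemClass.smul_mem _ h1) hk)
          (by rw [tr_add, tr_smul, tr_one, hk0]; field_simp; ring)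
        rw [norm_add, norm_smul, norm_one, bil_smul_left, bil_one_left, hk0] at h3
        have h4 : (4 : F) ≠ 0 := by
          have : (4 : F) = 2 * 2 := by norm_num
          rw [this]; exact mul_ne_zero h2 h2
        have h5 : 4 * norm k = 0 := by
          linear_combination -h3 - (2 * 2⁻¹ + 1) * mul_inv_cancel₀ h2
        exact (mul_eq_zero.1 h5).resolve_left h4
      have zero : ∀ k ∈ H, tr k = 0 → k = 0 := fun k hk hk0 => by
        refine hnd k hk fun y hy => ?_
        have hy' : tr (y - (tr y / 2) • (1 : Oct F)) = 0 := by
          rw [← bil_one_left, bil_sub_right, bil_smul_right, bil_one_left, bil_one_left, tr_one]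
          field_simp; ring
        have hyH : y - (tr y / 2) • (1 : Oct F) ∈ H := sub_mem hy (SMulMemClass.smul_mem _ h1)
        have h3 := key _ (add_mem hk hyH) (by rw [tr_add, hk0, hy', add_zero])
        rw [norm_add, key k hk hk0, key _ hyH hy', bil_sub_right, bil_smul_right, bil_comm k 1,
          bil_one_left, hk0] at h3
        simpa using h3
      have hle : H.toSubmodule ≤ Submodule.span F {(1 : Oct F)} := fun y hy => by
        refine Submodule.mem_span_singleton.2 ⟨tr y / 2, ?_⟩
        refine (sub_eq_zero.1 (zero _ (sub_mem hy (SMulMemClass.smul_mem _ h1)) ?_)).symm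
        rw [← bil_one_left, bil_sub_right, bil_smul_right, bil_one_left, bil_one_left, tr_one]
        field_simp; ring
      have h5 := Submodule.finrank_mono hle
      have h6 := finrank_span_le_card (R := F) ({(1 : Oct F)} : Set (Oct F))
      simp at h6
      omega
  obtain ⟨y, hy1, hy2, hy0, hHy⟩ := exists_range_quadMap hH hv1 hd hv
  obtain ⟨a, b, hab⟩ := exists_quadratic_eq hd ((n - norm v) / norm y)
  have hp := bil_lineMap_eq_zero.2 ⟨hy1, hy2⟩
  refine ⟨quadMap v y ((0, 1), (a, b)), ?_, ?_, ?_⟩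
  · have : quadMap v y ((0, 1), (a, b)) ∈ (H : Set (Oct F)) := by rw [hHy]; exact ⟨_, rfl⟩
    exact this
  · rw [quadMap_apply, tr_add, tr_lineMap hv1, ← bil_one_left (_ * y)]
    have := (isEmb_lineMap hv1).bil_mul_right hp (1, 0) (a, b)
    rw [lineMap_apply] at this
    simp only [one_smul, zero_smul, add_zero] at this
    rw [this]; ring
  · rw [quadMap, (isEmb_lineMap hv1).norm_double hp, norm_lineMap hv1, norm_lineMap hv1, hab]
    field_simp; ring

theorem mem_setH_iff [Finite F] {n : F} (hn : NoRoot n) (H : Subalg F) : H ∈ setH F ↔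
    ∃ u y, tr u = 1 ∧ norm u = n ∧ bil 1 y = 0 ∧ bil u y = 0 ∧ norm y ≠ 0 ∧
      (H : Set (Oct F)) = Set.range (quadMap u y) := by
  constructor
  · intro hH
    obtain ⟨u, huH, hu, rfl⟩ := exists_mem_setH_tr (n := n) hH
    obtain ⟨y, h⟩ := exists_range_quadMap hH hu hn.disc_ne huH
    exact ⟨u, y, hu, rfl, h⟩
  · rintro ⟨u, y, hu, rfl, h1, h2, hy, hH⟩
    have hnd := nondeg_quadMap hu hn.disc_ne h1 h2 hy
    have hmem : ∀ x, x ∈ H ↔ ∃ p, quadMap u y p = x := fun x => Set.ext_iff.1 hH x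
    refine ⟨(hmem _).2 (isEmb_quadMap hu h1 h2).one,
      (finrank_eq_of_coe_eq_range H hnd.injective hH).trans finrank_quad, fun x hx h => ?_⟩
    obtain ⟨p, rfl⟩ := (hmem x).1 hx
    rw [hnd p fun r => h _ ((hmem _).2 ⟨r, rfl⟩), map_zero]

/-! ### Invariance under automorphisms -/

namespace Aut

theorem map_one (α : Aut F) : α.1 1 = 1 := by
  obtain ⟨x, hx⟩ := α.1.surjective 1
  have := α.2 1 x
  rwa [one_mul, hx, mul_one, eq_comm] at this

/-- For non-scalar `x` the quadratic equation of `x` determines its trace and norm; scalars are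
fixed. -/
theorem tr_norm_map (α : Aut F) (x : Oct F) : tr (α.1 x) = tr x ∧ norm (α.1 x) = norm x := by
  by_cases hs : ∃ c : F, c • (1 : Oct F) = x
  · obtain ⟨c, rfl⟩ := hs
    rw [map_smul, map_one]
    exact ⟨rfl, rfl⟩
  · have h := α.2 x x
    rw [mul_self, mul_self, map_sub, map_smul, map_smul, map_one] at h
    have h' : (tr x - tr (α.1 x)) • α.1 x = (norm x - norm (α.1 x)) • (1 : Oct F) := by
      rw [sub_smul, sub_smul]
      rw [sub_eq_sub_iff_add_eq_add] at h ⊢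
      rw [h]; abel
    have ht : tr x - tr (α.1 x) = 0 := by
      by_contra ht
      refine hs ⟨(tr x - tr (α.1 x))⁻¹ * (norm x - norm (α.1 x)), α.1.injective ?_⟩
      rw [map_smul, map_one, mul_smul, ← h', smul_smul, inv_mul_cancel₀ ht, one_smul]
    refine ⟨(sub_eq_zero.1 ht).symm, ?_⟩
    rw [ht, zero_smul] at h'
    have h1 : (1 : Oct F) ≠ 0 := fun h => one_ne_zero (α := F) (by
      rw [← norm_one (F := F), h, norm_zero])
    exact (sub_eq_zero.1 ((smul_eq_zero.1 h'.symm).resolve_right h1)).symm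

theorem tr_map (α : Aut F) (x : Oct F) : tr (α.1 x) = tr x := (tr_norm_map α x).1
theorem norm_map (α : Aut F) (x : Oct F) : norm (α.1 x) = norm x := (tr_norm_map α x).2

theorem bil_map (α : Aut F) (x y : Oct F) : bil (α.1 x) (α.1 y) = bil x y := by
  simp only [bil, QuadraticMap.polar, ← map_add, norm_map]

theorem lineMap_map (α : Aut F) (u : Oct F) (p : F × F) :
    α.1 (lineMap u p) = lineMap (α.1 u) p := by
  simp only [lineMap_apply, map_add, map_smul, map_one]

theorem quadMap_map (α : Aut F) (u z : Oct F) (p : (F × F) × (F × F)) :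
    α.1 (quadMap u z p) = quadMap (α.1 u) (α.1 z) p := by
  rw [quadMap_apply, quadMap_apply, map_add, α.2, lineMap_map, lineMap_map]

theorem bil_one_map (α : Aut F) (x : Oct F) : bil 1 (α.1 x) = bil 1 x := by
  rw [bil_one_left, bil_one_left, tr_map]

theorem coe_smul (α : Aut F) (S : Subalg F) : ((α • S : Subalg F) : Set (Oct F)) = α.1 '' S := rfl

theorem coe_smul_line (α : Aut F) {S : Subalg F} {u : Oct F}
    (h : (S : Set (Oct F)) = Set.range (lineMap u)) :
    ((α • S : Subalg F) : Set (Oct F)) = Set.range (lineMap (α.1 u)) := by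
  rw [coe_smul, h, ← Set.range_comp]
  exact congrArg Set.range (funext fun p => lineMap_map α u p)

theorem coe_smul_quad (α : Aut F) {S : Subalg F} {u z : Oct F}
    (h : (S : Set (Oct F)) = Set.range (quadMap u z)) :
    ((α • S : Subalg F) : Set (Oct F)) = Set.range (quadMap (α.1 u) (α.1 z)) := by
  rw [coe_smul, h, ← Set.range_comp]
  exact congrArg Set.range (funext fun p => quadMap_map α u z p)

theorem smul_lt_smul_iff (α : Aut F) (S T : Subalg F) : α • S < α • T ↔ S < T := by
  have hle : ∀ A B : Subalg F, α • A ≤ α • B ↔ A ≤ B := fun A B => by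
    rw [← SetLike.coe_subset_coe, ← SetLike.coe_subset_coe (S := A), coe_smul, coe_smul]
    exact Set.image_subset_image_iff α.1.injective
  exact lt_iff_lt_of_le_iff_le' (hle T S) (hle S T)

variable [Finite F]

theorem smul_mem_setD (α : Aut F) {D : Subalg F} (hD : D ∈ setD F) : α • D ∈ setD F := by
  obtain ⟨n, hn⟩ := exists_noRoot (F := F)
  obtain ⟨u, hu, hun, h⟩ := (mem_setD_iff hn D).1 hD
  exact (mem_setD_iff hn _).2 ⟨α.1 u, by rw [tr_map, hu], by rw [norm_map, hun], coe_smul_line α h⟩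

theorem smul_mem_setX (α : Aut F) {X : Subalg F} (hX : X ∈ setX F) : α • X ∈ setX F := by
  obtain ⟨n, hn⟩ := exists_noRoot (F := F)
  obtain ⟨u, z, hu, hun, h1, h2, hz, hz0, h⟩ := (mem_setX_iff hn X).1 hX
  exact (mem_setX_iff hn _).2 ⟨α.1 u, α.1 z, by rw [tr_map, hu], by rw [norm_map, hun],
    by rw [bil_one_map, h1], by rw [bil_map, h2], by rw [norm_map, hz],
    by simpa using hz0, coe_smul_quad α h⟩

theorem smul_mem_setH (α : Aut F) {H : Subalg F} (hH : H ∈ setH F) : α • H ∈ setH F := by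
  obtain ⟨n, hn⟩ := exists_noRoot (F := F)
  obtain ⟨u, z, hu, hun, h1, h2, hz, h⟩ := (mem_setH_iff hn H).1 hH
  exact (mem_setH_iff hn _).2 ⟨α.1 u, α.1 z, by rw [tr_map, hu], by rw [norm_map, hun],
    by rw [bil_one_map, h1], by rw [bil_map, h2], by rw [norm_map]; exact hz, coe_smul_quad α h⟩

end Aut

/-! ### Generating triples and transitivity -/

/-- A generating triple of `𝕆`, obtained by successive doublings with given norms. -/
structure IsTriple (n c d : F) (u v w : Oct F) : Prop where
  tr_fst : tr u = 1
  norm_fst : norm u = n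
  one_snd : bil 1 v = 0
  fst_snd : bil u v = 0
  norm_snd : norm v = c
  perp : ∀ p, bil (quadMap u v p) w = 0
  norm_trd : norm w = d

theorem IsTriple.exists_aut {n c d : F} {u v w u' v' w' : Oct F} (hn : NoRoot n) (hc : c ≠ 0)
    (hd : d ≠ 0) (h : IsTriple n c d u v w) (h' : IsTriple n c d u' v' w') :
    ∃ α : Aut F, α.1 u = u' ∧ α.1 v = v' ∧ α.1 w = w' := by
  have key : ∀ {u v w : Oct F}, IsTriple n c d u v w →
      IsEmb (dmul d (dmul c (lmul n) lcj) (dcj lcj)) (dcj (dcj lcj)) (double (quadMap u v) w) ∧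
        Nondeg (double (quadMap u v) w) := by
    rintro u v w ⟨hu, rfl, h1, h2, rfl, hp, rfl⟩
    have he := isEmb_quadMap hu h1 h2
    exact ⟨he.double hp, (nondeg_quadMap hu hn.disc_ne h1 h2 hc).double he hp hd⟩
  obtain ⟨α, hα⟩ := (key h).1.exists_aut (key h').1 (key h).2 (key h').2 (by simp)
  simp only [double_apply, quadMap_apply, lineMap_apply] at hα
  refine ⟨α, ?_, ?_, ?_⟩
  · simpa using hα (((0, 1), 0), 0)
  · simpa using hα ((0, (1, 0)), 0)
  · simpa using hα (0, ((1, 0), 0))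

/-- Multiplying by an element of `F[u]` adjusts the norm of `w` to any value; the two lemmas after
it show that orthogonality survives. -/
theorem exists_norm_eq_smul [Finite F] {u w : Oct F} {c : F} (hu : tr u = 1)
    (hn : NoRoot (norm u)) (hw : norm w ≠ 0) : ∃ p, norm (lineMap u p * w) = c := by
  obtain ⟨a, b, hab⟩ := exists_quadratic_eq hn.disc_ne (c / norm w)
  exact ⟨(a, b), by rw [norm_mul, norm_lineMap hu, hab]; field_simp⟩

theorem bil_quadMap_lineMap_mul {u v w : Oct F} (hu : tr u = 1) (h1 : bil 1 v = 0)
    (h2 : bil u v = 0) (hw : ∀ p, bil (quadMap u v p) w = 0) (r : F × F)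
    (p : (F × F) × (F × F)) : bil (quadMap u v p) (lineMap u r * w) = 0 := by
  have := (isEmb_quadMap hu h1 h2).bil_mul_right hw p (r, 0)
  rwa [quadMap_apply u v (r, 0), map_zero, zero_mul, add_zero] at this

theorem bil_lineMap_mul {u v : Oct F} (hu : tr u = 1) (h1 : bil 1 v = 0)
    (h2 : bil u v = 0) (r : F × F) :
    bil 1 (lineMap u r * v) = 0 ∧ bil u (lineMap u r * v) = 0 :=
  bil_lineMap_eq_zero.1 fun p =>
    (isEmb_lineMap hu).bil_mul_right (bil_lineMap_eq_zero.2 ⟨h1, h2⟩) p r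

theorem exists_ne_of_finrank_lt {S : Type*} [AddCommGroup S] [Module F S] [Module.Finite F S]
    (f : S →ₗ[F] Oct F) (h : Module.finrank F S < 8) :
    ∃ x ∈ (⊤ : Submodule F (Oct F)), ∀ a, f a ≠ x := by
  by_contra! hx
  have h3 : LinearMap.range f = ⊤ := by
    rw [eq_top_iff]
    exact fun x hx' => hx x hx'
  have h5 := LinearMap.finrank_range_le f
  rw [h3, finrank_top, finrank_oct] at h5
  omega

theorem exists_snd [Finite F] {u : Oct F} (c : F) (hu : tr u = 1) (hn : NoRoot (norm u)) :
    ∃ v, bil 1 v = 0 ∧ bil u v = 0 ∧ norm v = c := by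
  obtain ⟨v, -, hv, hv0⟩ := (nondeg_lineMap hu hn.disc_ne).exists_perp ⊤
    (fun x _ h => eq_zero_of_bil fun y => h y trivial) (fun _ => trivial)
    (exists_ne_of_finrank_lt _ (by simp))
  obtain ⟨h1, h2⟩ := bil_lineMap_eq_zero.1 hv
  obtain ⟨p, hp⟩ := exists_norm_eq_smul (c := c) hu hn hv0
  exact ⟨_, (bil_lineMap_mul hu h1 h2 p).1, (bil_lineMap_mul hu h1 h2 p).2, hp⟩

theorem exists_trd [Finite F] {n c : F} (d : F) {u v : Oct F} (hn : NoRoot n) (hu : tr u = 1)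
    (hun : norm u = n) (h1 : bil 1 v = 0) (h2 : bil u v = 0) (hv : norm v = c) (hc : c ≠ 0) :
    ∃ w, IsTriple n c d u v w := by
  subst hun hv
  obtain ⟨w, -, hw, hw0⟩ := (nondeg_quadMap hu hn.disc_ne h1 h2 hc).exists_perp ⊤
    (fun x _ h => eq_zero_of_bil fun y => h y trivial) (fun _ => trivial)
    (exists_ne_of_finrank_lt _ (by simp))
  obtain ⟨p, hp⟩ := exists_norm_eq_smul (c := d) hu hn hw0
  exact ⟨_, hu, rfl, h1, h2, rfl, bil_quadMap_lineMap_mul hu h1 h2 hw p, hp⟩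

/-- An octonion of trace `1` and norm `n`. -/
def root (n : F) : Oct F := ((!![0, -n; 1, 1] : SplitQuat F), (0 : SplitQuat F))

theorem root_fst (n : F) : (root n).1 = !![0, -n; 1, 1] := rfl
theorem root_snd (n : F) : (root n).2 = 0 := rfl

theorem tr_root (n : F) : tr (root n) = 1 := by simp [tr, root_fst]

theorem norm_root (n : F) : norm (root n) = n := by simp [norm_eq, root_fst, root_snd]

theorem exists_fst (n : F) : ∃ u : Oct F, tr u = 1 ∧ norm u = n := ⟨_, tr_root n, norm_root n⟩

/-- Multiplying `z` by a unit of `F[u]` does not change `F[u] + F[u] z`. -/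
theorem range_quadMap_lineMap_mul {u z : Oct F} (hu : tr u = 1)
    (h1 : bil 1 z = 0) (h2 : bil u z = 0) {p : F × F} (hp : norm (lineMap u p) ≠ 0) :
    Set.range (quadMap u (lineMap u p * z)) = Set.range (quadMap u z) := by
  have hz := bil_lineMap_eq_zero.2 ⟨h1, h2⟩
  have hf := isEmb_lineMap hu
  have key : ∀ r, lineMap u r * (lineMap u p * z) = lineMap u (lmul (norm u) p r) * z := fun r => by
    rw [hf.map_mul, mul_mul_of_bil h1 (hz r) (hz p) (hf.bil_mul hz p r)]
  ext x
  constructor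
  · rintro ⟨⟨a, b⟩, rfl⟩
    exact ⟨(a, lmul (norm u) p b), by rw [quadMap_apply, quadMap_apply, key]⟩
  · rintro ⟨⟨a, b⟩, rfl⟩
    -- The inverse of `lineMap u p` is its conjugate divided by its norm.
    refine ⟨(a, (norm (lineMap u p))⁻¹ • lmul (norm u) (lcj p) b), ?_⟩
    rw [quadMap_apply, quadMap_apply, map_smul, smul_mul_assoc, key, hf.map_mul, hf.map_mul,
      hf.map_cj]
    have h3 := cj_mul_mul (cj (lineMap u p)) (lineMap u b)
    have hN : norm (cj (lineMap u p)) = norm (lineMap u p) := by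
      simp [norm_eq, cj_fst, cj_snd, SplitQuat.conj_apply]; ring
    rw [cj_cj, hN] at h3
    rw [h3, smul_mul_assoc, smul_smul, inv_mul_cancel₀ hp, one_smul]

theorem setD_nonempty [Finite F] : (setD F).Nonempty := by
  obtain ⟨n, hn⟩ := exists_noRoot (F := F)
  obtain ⟨u, hu, hun⟩ := exists_fst n
  exact ⟨_, (mem_setD_iff hn (isEmb_lineMap hu).range).2 ⟨u, hu, hun, rfl⟩⟩

theorem exists_smul_eq_of_mem_setD [Finite F] {D D' : Subalg F} (hD : D ∈ setD F)
    (hD' : D' ∈ setD F) : ∃ α : Aut F, α • D = D' := by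
  obtain ⟨n, hn⟩ := exists_noRoot (F := F)
  obtain ⟨u, hu, hun, h⟩ := (mem_setD_iff hn D).1 hD
  obtain ⟨u', hu', hun', h'⟩ := (mem_setD_iff hn D').1 hD'
  obtain ⟨v, h1, h2, hv⟩ := exists_snd 1 hu (hun ▸ hn)
  obtain ⟨v', h1', h2', hv'⟩ := exists_snd 1 hu' (hun' ▸ hn)
  obtain ⟨w, hw⟩ := exists_trd 1 hn hu hun h1 h2 hv one_ne_zero
  obtain ⟨w', hw'⟩ := exists_trd 1 hn hu' hun' h1' h2' hv' one_ne_zero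
  obtain ⟨α, hα, -⟩ := hw.exists_aut hn one_ne_zero one_ne_zero hw'
  exact ⟨α, SetLike.coe_injective (by rw [Aut.coe_smul_line α h, hα, h'])⟩

theorem exists_triple_of_mem_setH [Finite F] {n : F} (hn : NoRoot n) {H : Subalg F}
    (hH : H ∈ setH F) :
    ∃ u v w, IsTriple n 1 1 u v w ∧ (H : Set (Oct F)) = Set.range (quadMap u v) := by
  obtain ⟨u, z, hu, rfl, h1, h2, hz, h⟩ := (mem_setH_iff hn H).1 hH
  obtain ⟨p, hp⟩ := exists_norm_eq_smul (c := 1) hu hn hz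
  have hp0 : norm (lineMap u p) ≠ 0 := by
    intro h0
    rw [norm_mul, h0, zero_mul] at hp
    exact zero_ne_one hp
  obtain ⟨w, hw⟩ := exists_trd 1 hn hu rfl (bil_lineMap_mul hu h1 h2 p).1
    (bil_lineMap_mul hu h1 h2 p).2 hp one_ne_zero
  exact ⟨u, _, w, hw, by rw [h, range_quadMap_lineMap_mul hu h1 h2 hp0]⟩

theorem exists_smul_eq_of_mem_setH [Finite F] {H H' : Subalg F} (hH : H ∈ setH F)
    (hH' : H' ∈ setH F) : ∃ α : Aut F, α • H = H' := by
  obtain ⟨n, hn⟩ := exists_noRoot (F := F)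
  obtain ⟨u, v, w, ht, h⟩ := exists_triple_of_mem_setH hn hH
  obtain ⟨u', v', w', ht', h'⟩ := exists_triple_of_mem_setH hn hH'
  obtain ⟨α, hα, hα', -⟩ := ht.exists_aut hn one_ne_zero one_ne_zero ht'
  exact ⟨α, SetLike.coe_injective (by rw [Aut.coe_smul_quad α h, hα, hα', h'])⟩

/-- Choose an anisotropic `v` orthogonal to `F[u]` but not to `z`, and split `z` along `F[u] +
F[u]v` and its orthogonal space. The two parts have opposite non-zero norms, and one factor from
`F[u]` scales them to 1 and -1. -/
theorem exists_triple_of_isotropic [Finite F] {u z : Oct F} (hu : tr u = 1)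
    (hn : NoRoot (norm u)) (h1 : bil 1 z = 0) (h2 : bil u z = 0) (hz : norm z = 0) (hz0 : z ≠ 0) :
    ∃ p v w, norm (lineMap u p) ≠ 0 ∧ IsTriple (norm u) 1 (-1) u v w ∧
      lineMap u p * z = v + w := by
  have hf := isEmb_lineMap hu
  have hnd := nondeg_lineMap hu hn.disc_ne
  -- a vector of non-zero norm that is not orthogonal to `z`
  obtain ⟨v, hv1, hv2, hv0, hvz⟩ : ∃ v, bil 1 v = 0 ∧ bil u v = 0 ∧ norm v ≠ 0 ∧ bil v z ≠ 0 := by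
    obtain ⟨y, hy⟩ : ∃ y, bil z y ≠ 0 := by
      by_contra! h
      exact hz0 (eq_zero_of_bil h)
    obtain ⟨a, ha⟩ := hnd.exists_proj y
    obtain ⟨ha1, ha2⟩ := bil_lineMap_eq_zero.1 ha
    have hyz : bil (y - lineMap u a) z ≠ 0 := by
      rwa [bil_comm, bil_sub_right, bil_comm z (lineMap u a), bil_lineMap_eq_zero.2 ⟨h1, h2⟩,
        sub_zero]
    by_cases h0 : norm (y - lineMap u a) = 0
    · refine ⟨(y - lineMap u a) + z, ?_, ?_, ?_, ?_⟩
      · rw [bil_add_right, ha1, h1, add_zero]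
      · rw [bil_add_right, ha2, h2, add_zero]
      · rw [norm_add, h0, hz]; simpa using hyz
      · rw [bil_add_left, bil_self, hz]; simpa using hyz
    · exact ⟨_, ha1, ha2, h0, hyz⟩
  have hvp := bil_lineMap_eq_zero.2 ⟨hv1, hv2⟩
  obtain ⟨⟨a, b⟩, hw⟩ := (nondeg_quadMap hu hn.disc_ne hv1 hv2 hv0).exists_proj z
  set w := z - quadMap u v (a, b) with hwdef
  have ha : a = 0 := hnd a fun y => by
    have h3 := hw (y, 0)
    rw [hwdef, bil_sub_right, quadMap, hf.bil_double hvp, double_apply] at h3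
    simp only [map_zero, zero_mul, add_zero, bil_zero_left, mul_zero,
      bil_lineMap_eq_zero.2 ⟨h1, h2⟩, zero_sub, neg_eq_zero] at h3
    rw [bil_comm, h3]
  have hzw : z = lineMap u b * v + w := by
    rw [hwdef, ha, quadMap_apply, map_zero, zero_add]; abel
  -- Otherwise `z = w` would be orthogonal to `v`.
  have hb0 : norm (lineMap u b) ≠ 0 := by
    intro h0
    rw [norm_lineMap_eq_zero hu hn h0, map_zero, zero_mul, zero_add] at hzw
    have h3 := hw (0, (1, 0))
    rw [← hzw, quadMap_apply, map_zero, zero_add, lineMap_apply] at h3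
    simp at h3
    exact hvz h3
  have hbv : norm (lineMap u b * v) ≠ 0 := by
    rw [norm_mul]; exact mul_ne_zero hb0 hv0
  have hwn : norm w = - norm (lineMap u b * v) := by
    have h3 := hw (0, b)
    rw [quadMap_apply, map_zero, zero_add] at h3
    rw [hzw, norm_add, h3, add_zero] at hz
    linear_combination hz
  obtain ⟨p, hp⟩ := exists_norm_eq_smul (c := 1) hu hn hbv
  have hp0 : norm (lineMap u p) ≠ 0 := by
    intro h0
    rw [norm_mul, h0, zero_mul] at hp
    exact zero_ne_one hp
  have hbp := bil_lineMap_mul hu hv1 hv2 b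
  have hpp := bil_lineMap_mul hu hbp.1 hbp.2 p
  refine ⟨p, lineMap u p * (lineMap u b * v), lineMap u p * w, hp0,
    ⟨hu, rfl, hpp.1, hpp.2, hp, fun r => ?_, ?_⟩, by rw [hzw, mul_add]⟩
  · have hmem : quadMap u (lineMap u p * (lineMap u b * v)) r ∈ Set.range (quadMap u v) := by
      rw [← range_quadMap_lineMap_mul hu hv1 hv2 hb0,
        ← range_quadMap_lineMap_mul hu hbp.1 hbp.2 hp0]
      exact ⟨r, rfl⟩
    obtain ⟨r', hr'⟩ := hmem
    rw [← hr']
    exact bil_quadMap_lineMap_mul hu hv1 hv2 hw p r'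
  · rw [norm_mul, hwn, mul_neg, ← norm_mul, hp]

theorem exists_triple_of_mem_setX [Finite F] {n : F} (hn : NoRoot n) {X : Subalg F}
    (hX : X ∈ setX F) :
    ∃ u v w, IsTriple n 1 (-1) u v w ∧ (X : Set (Oct F)) = Set.range (quadMap u (v + w)) := by
  obtain ⟨u, z, hu, rfl, h1, h2, hz, hz0, h⟩ := (mem_setX_iff hn X).1 hX
  obtain ⟨p, v, w, hp, ht, hvw⟩ := exists_triple_of_isotropic hu hn h1 h2 hz hz0
  exact ⟨u, v, w, ht, by rw [h, ← hvw, range_quadMap_lineMap_mul hu h1 h2 hp]⟩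

theorem exists_smul_eq_of_mem_setX [Finite F] {X X' : Subalg F} (hX : X ∈ setX F)
    (hX' : X' ∈ setX F) : ∃ α : Aut F, α • X = X' := by
  obtain ⟨n, hn⟩ := exists_noRoot (F := F)
  obtain ⟨u, v, w, ht, h⟩ := exists_triple_of_mem_setX hn hX
  obtain ⟨u', v', w', ht', h'⟩ := exists_triple_of_mem_setX hn hX'
  obtain ⟨α, hα, hα', hα''⟩ := ht.exists_aut hn one_ne_zero (neg_ne_zero.2 one_ne_zero) ht'
  exact ⟨α, SetLike.coe_injective (by
    rw [Aut.coe_smul_quad α h, hα, map_add, hα', hα'', h'])⟩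

theorem setH_nonempty [Finite F] : (setH F).Nonempty := by
  obtain ⟨n, hn⟩ := exists_noRoot (F := F)
  obtain ⟨u, hu, rfl⟩ := exists_fst n
  obtain ⟨v, h1, h2, hv⟩ := exists_snd 1 hu hn
  exact ⟨_, (mem_setH_iff hn (isEmb_quadMap hu h1 h2).range).2
    ⟨u, v, hu, rfl, h1, h2, by rw [hv]; exact one_ne_zero, rfl⟩⟩

theorem setX_nonempty [Finite F] : (setX F).Nonempty := by
  obtain ⟨n, hn⟩ := exists_noRoot (F := F)
  obtain ⟨u, hu, rfl⟩ := exists_fst n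
  obtain ⟨v, h1, h2, hv⟩ := exists_snd 1 hu hn
  obtain ⟨w, hw⟩ := exists_trd (-1) hn hu rfl h1 h2 hv one_ne_zero
  have hp : ∀ p, bil (lineMap u p) w = 0 := fun p => by
    have := hw.perp (p, 0)
    rwa [quadMap_apply, map_zero, zero_mul, add_zero] at this
  obtain ⟨hw1, hw2⟩ := bil_lineMap_eq_zero.1 hp
  have hvw : bil v w = 0 := by
    have := hw.perp (0, (1, 0))
    rw [quadMap_apply, map_zero, zero_add, lineMap_apply] at this
    simpa using this
  have hz1 : bil 1 (v + w) = 0 := by rw [bil_add_right, h1, hw1, add_zero]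
  have hz2 : bil u (v + w) = 0 := by rw [bil_add_right, h2, hw2, add_zero]
  refine ⟨_, (mem_setX_iff hn (isEmb_quadMap hu hz1 hz2).range).2
    ⟨u, v + w, hu, rfl, hz1, hz2, ?_, fun h => ?_, rfl⟩⟩
  · rw [norm_add, hv, hw.norm_trd, hvw]; ring
  -- `v + w` is non-zero because the double doubling by `v` and `w` is injective.
  · have hnd := (nondeg_quadMap hu hn.disc_ne h1 h2 (by rw [hv]; exact one_ne_zero)).double
      (isEmb_quadMap hu h1 h2) hw.perp (by rw [hw.norm_trd]; exact neg_ne_zero.2 one_ne_zero)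
    have h3 : double (quadMap u v) w ((0, (1, 0)), ((1, 0), 0)) = 0 := by
      simpa [double_apply, quadMap_apply, lineMap_apply] using h
    have h4 := hnd.injective (h3.trans (map_zero _).symm)
    simp at h4

theorem eq_orbit {A : Set (Subalg F)} (hne : A.Nonempty)
    (hs : ∀ (α : Aut F) {S}, S ∈ A → α • S ∈ A)
    (ht : ∀ {S T}, S ∈ A → T ∈ A → ∃ α : Aut F, α • S = T) :
    ∃ S, A = MulAction.orbit (Aut F) S := by
  obtain ⟨S, hS⟩ := hne
  refine ⟨S, Set.Subset.antisymm (fun T hT => ht hS hT) ?_⟩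
  rintro _ ⟨α, rfl⟩
  exact hs α hS

/-! ### Counting in coordinates -/

theorem ncard_mul_eq {α β : Type*} [Finite α] [Finite β] (r : α → β → Prop) {s : Set α}
    {t : Set β} {m n : ℕ} (hm : ∀ a ∈ s, {b ∈ t | r a b}.ncard = m)
    (hn : ∀ b ∈ t, {a ∈ s | r a b}.ncard = n) : s.ncard * m = t.ncard * n := by
  classical
  have := Fintype.ofFinite α
  have := Fintype.ofFinite β
  rw [Set.ncard_eq_toFinset_card' s, Set.ncard_eq_toFinset_card' t]
  refine Finset.card_mul_eq_card_mul r (fun a ha => ?_) fun b hb => ?_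
  · rw [← hm a (Set.mem_toFinset.1 ha), Set.ncard_eq_toFinset_card']
    congr 1; ext b; simp [Finset.mem_bipartiteAbove]
  · rw [← hn b (Set.mem_toFinset.1 hb), Set.ncard_eq_toFinset_card']
    congr 1; ext a; simp [Finset.mem_bipartiteBelow]

theorem exists_aut_map_eq [Finite F] {u u' : Oct F} (hu : tr u = 1) (hu' : tr u' = 1)
    (hn : NoRoot (norm u)) (h : norm u' = norm u) : ∃ α : Aut F, α.1 u = u' := by
  obtain ⟨v, h1, h2, hv⟩ := exists_snd 1 hu hn
  obtain ⟨v', h1', h2', hv'⟩ := exists_snd 1 hu' (h ▸ hn)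
  obtain ⟨w, hw⟩ := exists_trd 1 hn hu rfl h1 h2 hv one_ne_zero
  obtain ⟨w', hw'⟩ := exists_trd 1 hn hu' h h1' h2' hv' one_ne_zero
  obtain ⟨α, hα, -⟩ := hw.exists_aut hn one_ne_zero one_ne_zero hw'
  exact ⟨α, hα⟩

section Card

variable [Finite F] {n : F}

theorem exists_card_eq_succ : ∃ k : ℕ, Nat.card F = k + 2 := by
  have := Finite.one_lt_card (α := F)
  exact ⟨Nat.card F - 2, by omega⟩

theorem card_noRoot (hn : NoRoot n) : Nat.card {r : F // r * (1 - r) - n = 0} = 0 := by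
  rw [Nat.card_eq_zero]
  exact Or.inl ⟨fun r => hn r.1 (sub_eq_zero.1 r.2)⟩

theorem card_mul_noRoot (hn : NoRoot n) :
    Nat.card {p : F × F × F // p.1 * p.2.1 = p.2.2 * (1 - p.2.2) - n} =
      (Nat.card F - 1) * Nat.card F := by
  rw [card_mul_eq (fun r : F => r * (1 - r) - n), card_noRoot hn, mul_zero, zero_add]

theorem ncard_roots (hn : NoRoot n) :
    {u : Oct F | tr u = 1 ∧ norm u = n}.ncard + Nat.card F ^ 3 = Nat.card F ^ 6 := by
  -- Trace 1 eliminates one diagonal entry. Norm `n` then reads `b c = f g - (e h + n - a (1 - a))`;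
  -- `card_mul_eq` peels off `b c`, `f g` and `e h` in turn, and `a (1 - a) = n` has no solution.
  let g2 : F × F × F → F := fun p => p.1 * p.2.1 + n - p.2.2 * (1 - p.2.2)
  let g3 : F × F × F × F × F → F := fun p => p.1 * p.2.1 - g2 p.2.2
  have e : {u : Oct F | tr u = 1 ∧ norm u = n} ≃
      {p : F × F × F × F × F × F × F // p.1 * p.2.1 = g3 p.2.2} :=
    { toFun := fun u => ⟨(u.1.1 0 1, u.1.1 1 0, u.1.2 0 1, u.1.2 1 0, u.1.2 0 0, u.1.2 1 1,
        u.1.1 0 0), by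
          obtain ⟨u, h1, h2⟩ := u
          simp only [tr, norm_eq, g3, g2] at h1 h2 ⊢
          linear_combination -h2 + u.1 0 0 * h1⟩
      invFun := fun p => ⟨((!![p.1.2.2.2.2.2.2, p.1.1; p.1.2.1, 1 - p.1.2.2.2.2.2.2] : SplitQuat F),
        (!![p.1.2.2.2.2.1, p.1.2.2.1; p.1.2.2.2.1, p.1.2.2.2.2.2.1] : SplitQuat F)), by
          obtain ⟨⟨b, c, f, g, e, h, a⟩, hp⟩ := p
          simp only [g3, g2] at hp
          refine ⟨add_sub_cancel a 1, (norm_eq _).trans ?_⟩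
          simp
          linear_combination -hp⟩
      left_inv := by
        rintro ⟨u, h1, h2⟩
        refine Subtype.ext (ext_coord ?_ ?_) <;> simp only [Fin.forall_fin_two] <;>
          refine ⟨⟨?_, ?_⟩, ?_, ?_⟩ <;> try rfl
        exact (eq_sub_of_add_eq' h1).symm
      right_inv := fun p => rfl }
  have h3 : Nat.card {p // g3 p = 0} = Nat.card {p : F × F × F × F × F // p.1 * p.2.1 = g2 p.2.2} :=
    Nat.card_congr (Equiv.subtypeEquivRight fun p => sub_eq_zero)
  have h2 : Nat.card {p // g2 p = 0} = (Nat.card F - 1) * Nat.card F := by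
    rw [← card_mul_noRoot hn]
    refine Nat.card_congr (Equiv.subtypeEquivRight fun p => ?_)
    rw [← sub_eq_zero (a := p.1 * p.2.1)]
    have : g2 p = p.1 * p.2.1 - (p.2.2 * (1 - p.2.2) - n) := by simp only [g2]; ring
    rw [this]
  rw [← Nat.card_coe_set_eq, Nat.card_congr e, card_mul_eq g3, h3, card_mul_eq g2, h2]
  obtain ⟨k, hk⟩ := exists_card_eq_succ (F := F)
  simp only [Nat.card_prod, hk, show k + 2 - 1 = k + 1 from rfl]
  ring

/-- Coordinates on the orthogonal space of `1` and `root n`. -/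
def perpEquiv (n : F) : {y : Oct F // bil 1 y = 0 ∧ bil (root n) y = 0} ≃
    F × F × F × F × F × F where
  toFun y := (y.1.2 0 0, y.1.2 1 1, y.1.2 0 1, y.1.2 1 0, y.1.1 0 0, y.1.1 1 0)
  invFun p := ⟨((!![p.2.2.2.2.1, p.2.2.2.2.1 + n * p.2.2.2.2.2; p.2.2.2.2.2, -p.2.2.2.2.1] :
      SplitQuat F), (!![p.1, p.2.2.1; p.2.2.2.1, p.2.1] : SplitQuat F)), by
    refine ⟨(bil_one_left _).trans (add_neg_cancel _), (bil_eq _ _).trans ?_⟩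
    simp [root_fst, root_snd]⟩
  left_inv := by
    rintro ⟨y, h1, h2⟩
    rw [bil_one_left, tr] at h1
    rw [bil_eq] at h2
    simp [root_fst, root_snd] at h2
    refine Subtype.ext (ext_coord ?_ ?_) <;> simp only [Fin.forall_fin_two] <;>
      refine ⟨⟨?_, ?_⟩, ?_, ?_⟩ <;> try rfl
    · change y.1 0 0 + n * y.1 1 0 = y.1 0 1
      linear_combination h2
    · exact (eq_neg_of_add_eq_zero_right h1).symm
  right_inv _ := rfl

/-- The space orthogonal to `F[u]` is two hyperbolic planes plus the negative of the norm form of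
`F[u]`, which is anisotropic when `NoRoot n` holds. -/
theorem norm_perpEquiv_symm (n : F) (p : F × F × F × F × F × F) :
    norm ((perpEquiv n).symm p).1 = p.2.2.1 * p.2.2.2.1 -
      (p.2.2.2.2.1 ^ 2 + p.2.2.2.2.1 * p.2.2.2.2.2 + n * p.2.2.2.2.2 ^ 2) - p.1 * p.2.1 := by
  refine (norm_eq _).trans ?_
  change p.2.2.2.2.1 * -p.2.2.2.2.1 - (p.2.2.2.2.1 + n * p.2.2.2.2.2) * p.2.2.2.2.2 -
    (p.1 * p.2.1 - p.2.2.1 * p.2.2.2.1) = _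
  ring

/-- An automorphism carries `root (norm u)` to `u`, so counting with the explicit coordinates is
enough. -/
theorem ncard_perp_norm {u : Oct F} (hu : tr u = 1) (hn : NoRoot (norm u)) (P : F → Prop) :
    {y : Oct F | bil 1 y = 0 ∧ bil u y = 0 ∧ P (norm y)}.ncard =
      {p | P (norm ((perpEquiv (norm u)).symm p).1)}.ncard := by
  obtain ⟨α, hα⟩ := exists_aut_map_eq (tr_root (norm u)) hu (by rwa [norm_root])
    (norm_root _).symm
  symm
  refine Set.ncard_congr (fun p _ => α.1 ((perpEquiv (norm u)).symm p).1) ?_ ?_ ?_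
  · intro p hp
    refine ⟨?_, ?_, ?_⟩
    · rw [Aut.bil_one_map, ((perpEquiv (norm u)).symm p).2.1]
    · nth_rw 1 [← hα]
      rw [Aut.bil_map, ((perpEquiv (norm u)).symm p).2.2]
    · rw [Aut.norm_map]; exact hp
  · intro p r _ _ h
    exact (perpEquiv (norm u)).symm.injective (Subtype.ext (α.1.injective h))
  · rintro y ⟨h1, h2, hy⟩
    obtain ⟨y, rfl⟩ := α.1.surjective y
    rw [Aut.bil_one_map] at h1
    nth_rw 1 [← hα] at h2
    rw [Aut.bil_map] at h2
    rw [Aut.norm_map] at hy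
    refine ⟨perpEquiv (norm u) ⟨y, h1, h2⟩, ?_, ?_⟩ <;>
      simp only [Set.mem_ofPred_eq, Equiv.symm_apply_apply]
    exact hy

theorem card_isotropic (hn : NoRoot n) :
    {p | norm ((perpEquiv n).symm p).1 = 0}.ncard + Nat.card F ^ 3 =
      Nat.card F ^ 5 + Nat.card F ^ 2 := by
  let g1 : F × F → F := fun p => p.1 ^ 2 + p.1 * p.2 + n * p.2 ^ 2
  let g2 : F × F × F × F → F := fun p => p.1 * p.2.1 - g1 p.2.2
  have h0 : Nat.card {p // norm ((perpEquiv n).symm p).1 = 0} =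
      Nat.card {p : F × F × F × F × F × F // p.1 * p.2.1 = g2 p.2.2} := by
    refine Nat.card_congr (Equiv.subtypeEquivRight fun p => ?_)
    rw [norm_perpEquiv_symm, sub_eq_zero, eq_comm]
  have h2 : Nat.card {p // g2 p = 0} = Nat.card {p : F × F × F × F // p.1 * p.2.1 = g1 p.2.2} :=
    Nat.card_congr (Equiv.subtypeEquivRight fun p => sub_eq_zero)
  have h1 : Nat.card {p // g1 p = 0} = 1 := by
    rw [Nat.card_eq_one_iff_unique]
    have key : ∀ p, g1 p = 0 → p = 0 := fun p hp => Prod.ext (hn.eq_zero hp).1 (hn.eq_zero hp).2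
    exact ⟨⟨fun p r => Subtype.ext ((key _ p.2).trans (key _ r.2).symm)⟩, ⟨0, by simp [g1]⟩⟩
  rw [← Nat.card_coe_set_eq]
  change Nat.card {p // norm ((perpEquiv n).symm p).1 = 0} + _ = _
  rw [h0, card_mul_eq g2, h2, card_mul_eq g1, h1]
  obtain ⟨k, hk⟩ := exists_card_eq_succ (F := F)
  simp only [Nat.card_prod, hk, show k + 2 - 1 = k + 1 from rfl]
  ring

theorem ncard_isotropic {u : Oct F} (hu : tr u = 1) (hn : NoRoot (norm u)) :
    {y : Oct F | (bil 1 y = 0 ∧ bil u y = 0 ∧ norm y = 0) ∧ y ≠ 0}.ncard + 1 + Nat.card F ^ 3 =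
      Nat.card F ^ 5 + Nat.card F ^ 2 := by
  rw [← card_isotropic hn, ← ncard_perp_norm hu hn fun x => x = 0]
  congr 1
  refine Set.ncard_sdiff_singleton_add_one ?_ (Set.toFinite _)
  exact ⟨bil_zero_right _, bil_zero_right _, norm_zero⟩

theorem ncard_anisotropic {u : Oct F} (hu : tr u = 1) (hn : NoRoot (norm u)) :
    {y : Oct F | bil 1 y = 0 ∧ bil u y = 0 ∧ norm y ≠ 0}.ncard + Nat.card F ^ 5 + Nat.card F ^ 2 =
      Nat.card F ^ 6 + Nat.card F ^ 3 := by
  rw [ncard_perp_norm hu hn fun x => x ≠ 0, add_assoc, ← card_isotropic hn, ← add_assoc]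
  congr 1
  rw [add_comm]
  refine (Set.ncard_add_ncard_compl _).trans ?_
  simp only [Nat.card_prod]
  ring

variable (F) in
/-- The quaternion subalgebra `ℍ` of `𝕆`. -/
def quat : Subalg F where
  carrier := {x | x.2 = 0}
  add_mem' := by
    intro x y hx hy
    change x.2 + y.2 = 0
    rw [show x.2 = 0 from hx, show y.2 = 0 from hy, add_zero]
  zero_mem' := rfl
  smul_mem' := by
    intro c x hx
    change c • x.2 = 0
    rw [show x.2 = 0 from hx, smul_zero]
  mul_mem' := by
    intro x y hx hy
    change y.2 * x.1 + x.2 * SplitQuat.conj y.1 = 0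
    rw [show x.2 = 0 from hx, show y.2 = 0 from hy, zero_mul, zero_mul, add_zero]

theorem mem_quat {x : Oct F} : x ∈ quat F ↔ x.2 = 0 := Iff.rfl

theorem quat_mem_setH : quat F ∈ setH F := by
  refine ⟨rfl, ?_, fun x hx h => eq_zero_of_bil fun y => ?_⟩
  · let f : Matrix (Fin 2) (Fin 2) F →ₗ[F] Oct F :=
      (coords (F := F)).symm.toLinearMap ∘ₗ LinearMap.inl F _ _
    have hf : Function.Injective f := (coords (F := F)).symm.injective.comp LinearMap.inl_injective
    have hr : (quat F : Set (Oct F)) = Set.range f := by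
      ext x
      refine ⟨fun hx => ⟨x.1, Oct.ext rfl hx.symm⟩, ?_⟩
      rintro ⟨a, rfl⟩
      exact rfl
    rw [finrank_eq_of_coe_eq_range _ hf hr, Module.finrank_matrix]; simp
  · have := (bil_eq x _).symm.trans (h ((y.1, (0 : SplitQuat F)) : SplitQuat F × SplitQuat F) rfl)
    rw [bil_eq]
    simpa [mem_quat.1 hx] using this

theorem ncard_roots_quat (hn : NoRoot n) :
    {x : Oct F | (tr x = 1 ∧ norm x = n) ∧ x ∈ quat F}.ncard = (Nat.card F - 1) * Nat.card F := by
  rw [← card_mul_noRoot hn, ← Nat.card_coe_set_eq]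
  refine Nat.card_congr
    { toFun := fun u => ⟨(u.1.1 0 1, u.1.1 1 0, u.1.1 0 0), by
        obtain ⟨u, ⟨h1, h2⟩, h3⟩ := u
        rw [mem_quat] at h3
        simp only [tr, norm_eq, h3, Matrix.zero_apply] at h1 h2 ⊢
        linear_combination -h2 + u.1 0 0 * h1⟩
      invFun := fun p => ⟨((!![p.1.2.2, p.1.1; p.1.2.1, 1 - p.1.2.2] : SplitQuat F),
        (0 : SplitQuat F)), by
          refine ⟨⟨add_sub_cancel _ _, (norm_eq _).trans ?_⟩, rfl⟩
          simp
          linear_combination -p.2⟩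
      left_inv := ?_
      right_inv := fun p => rfl }
  rintro ⟨u, ⟨h1, h2⟩, h3⟩
  refine Subtype.ext (Oct.ext (Matrix.ext ?_) (mem_quat.1 h3).symm)
  simp only [Fin.forall_fin_two]
  refine ⟨⟨?_, ?_⟩, ?_, ?_⟩ <;> try rfl
  exact (eq_sub_of_add_eq' h1).symm

/-- By transitivity on `setH F` it suffices to count in `ℍ` itself. -/
theorem ncard_roots_of_mem_setH (hn : NoRoot n) {H : Subalg F} (hH : H ∈ setH F) :
    {x : Oct F | (tr x = 1 ∧ norm x = n) ∧ x ∈ H}.ncard = (Nat.card F - 1) * Nat.card F := by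
  obtain ⟨α, rfl⟩ := exists_smul_eq_of_mem_setH quat_mem_setH hH
  rw [← ncard_roots_quat hn,
    ← Set.ncard_image_of_injective {x : Oct F | (tr x = 1 ∧ norm x = n) ∧ x ∈ quat F} α.1.injective]
  congr 1
  ext x
  constructor
  · rintro ⟨⟨h1, h2⟩, y, hy, rfl⟩
    exact ⟨y, ⟨⟨(Aut.tr_map α y).symm.trans h1, (Aut.norm_map α y).symm.trans h2⟩, hy⟩, rfl⟩
  · rintro ⟨y, ⟨⟨h1, h2⟩, hy⟩, rfl⟩
    exact ⟨⟨(Aut.tr_map α y).trans h1, (Aut.norm_map α y).trans h2⟩, y, hy, rfl⟩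

end Card

/-! ### Incidence counts -/

/-- The two solutions are `u` and its conjugate `1 - u`. -/
theorem lineMap_root_iff {u : Oct F} (hu : tr u = 1) (hn : NoRoot (norm u)) (p : F × F) :
    tr (lineMap u p) = 1 ∧ norm (lineMap u p) = norm u ↔ p = (0, 1) ∨ p = (1, -1) := by
  rw [tr_lineMap hu, norm_lineMap hu]
  constructor
  · rintro ⟨h1, h2⟩
    have hb : p.2 = 1 - 2 * p.1 := by linear_combination h1
    rw [hb] at h2
    have h3 : (1 - 4 * norm u) * (p.1 * (1 - p.1)) = 0 := by linear_combination h2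
    have h4 := (mul_eq_zero.1 h3).resolve_left hn.disc_ne
    rcases mul_eq_zero.1 h4 with h | h
    · left
      refine Prod.ext h ?_
      rw [hb, h]; ring
    · right
      have h' : p.1 = 1 := (sub_eq_zero.1 h).symm
      refine Prod.ext h' ?_
      rw [hb, h']; ring
  · rintro (rfl | rfl)
    · constructor <;> ring
    · constructor <;> ring

theorem pair_ne : ((0 : F), (1 : F)) ≠ (1, -1) := fun h => zero_ne_one (congrArg Prod.fst h)

section

variable [Finite F]

theorem mem_line {D : Subalg F} {u : Oct F} (hDu : (D : Set (Oct F)) = Set.range (lineMap u)) :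
    1 ∈ D ∧ u ∈ D := by
  have h : ∀ p, lineMap u p ∈ D := fun p => by
    have : lineMap u p ∈ (D : Set (Oct F)) := by rw [hDu]; exact ⟨p, rfl⟩
    exact this
  exact ⟨by simpa [lineMap_apply] using h (1, 0), by simpa [lineMap_apply] using h (0, 1)⟩

theorem lineMap_mem {Y : Subalg F} {u : Oct F} (h1 : 1 ∈ Y) (hu : u ∈ Y) (p : F × F) :
    lineMap u p ∈ Y := by
  rw [lineMap_apply]
  exact add_mem (SMulMemClass.smul_mem _ h1) (SMulMemClass.smul_mem _ hu)

theorem quadMap_mem {Y : Subalg F} {u z : Oct F} (h1 : 1 ∈ Y) (hu : u ∈ Y) (hz : z ∈ Y)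
    (p : (F × F) × (F × F)) : quadMap u z p ∈ Y := by
  rw [quadMap_apply]
  exact add_mem (lineMap_mem h1 hu _) (mul_mem (lineMap_mem h1 hu _) hz)

theorem mem_quad {Y : Subalg F} {u z : Oct F} (h : (Y : Set (Oct F)) = Set.range (quadMap u z)) :
    1 ∈ Y ∧ u ∈ Y ∧ z ∈ Y := by
  have h : ∀ p, quadMap u z p ∈ Y := fun p => by
    have : quadMap u z p ∈ (Y : Set (Oct F)) := by rw [h]; exact ⟨p, rfl⟩
    exact this
  simp only [quadMap_apply, lineMap_apply] at h
  exact ⟨by simpa using h ((1, 0), 0), by simpa using h ((0, 1), 0), by simpa using h (0, (1, 0))⟩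

theorem one_mem_of_mem_setD {D : Subalg F} (hD : D ∈ setD F) : 1 ∈ D := by
  obtain ⟨n, hn⟩ := exists_noRoot (F := F)
  obtain ⟨u, -, -, h⟩ := (mem_setD_iff hn D).1 hD
  exact (mem_line h).1

/-- An element of trace `1` and norm `n` lies in exactly one member of `setD F`. -/
theorem coe_eq_of_mem {D : Subalg F} (hD : D ∈ setD F) {u : Oct F} (hu : tr u = 1)
    (hn : NoRoot (norm u)) (huD : u ∈ D) : (D : Set (Oct F)) = Set.range (lineMap u) :=
  coe_eq_range_of_finrank D (lineMap_injective hu hn)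
    (lineMap_mem (one_mem_of_mem_setD hD) huD) (hD.1.trans finrank_line.symm)

/-- A member of `setD F` contains exactly two elements of trace `1` and norm `n`. -/
theorem ncard_roots_of_mem_setD {n : F} (hn : NoRoot n) {D : Subalg F} (hD : D ∈ setD F) :
    {u : Oct F | (tr u = 1 ∧ norm u = n) ∧ u ∈ D}.ncard = 2 := by
  obtain ⟨u, hu, rfl, h⟩ := (mem_setD_iff hn D).1 hD
  have hmem : ∀ x, x ∈ D ↔ ∃ p, lineMap u p = x := fun x => Set.ext_iff.1 h x
  have : {x : Oct F | (tr x = 1 ∧ norm x = norm u) ∧ x ∈ D} =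
      lineMap u '' {(0, 1), (1, -1)} := by
    ext x
    constructor
    · rintro ⟨hx, hxD⟩
      obtain ⟨p, rfl⟩ := (hmem x).1 hxD
      exact ⟨p, (lineMap_root_iff hu hn p).1 hx, rfl⟩
    · rintro ⟨p, hp, rfl⟩
      exact ⟨(lineMap_root_iff hu hn p).2 hp, (hmem _).2 ⟨p, rfl⟩⟩
  rw [this, Set.ncard_image_of_injective _ (lineMap_injective hu hn), Set.ncard_pair pair_ne]

/-- The number of members of `setD F` inside a unital subalgebra. -/
theorem ncard_setD_lt {n : F} (hn : NoRoot n) {Y : Subalg F} (h1 : 1 ∈ Y)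
    (hY : 2 < Module.finrank F Y.toSubmodule) :
    {u : Oct F | (tr u = 1 ∧ norm u = n) ∧ u ∈ Y}.ncard = {D ∈ setD F | D < Y}.ncard * 2 := by
  -- Count pairs `u ∈ D`: each root lies in one `D`, each `D` contains two roots.
  rw [← mul_one (Set.ncard _)]
  refine ncard_mul_eq (fun u D => u ∈ D) ?_ ?_
  · rintro u ⟨⟨hu, rfl⟩, huY⟩
    rw [Set.ncard_eq_one]
    refine ⟨(isEmb_lineMap hu).range, Set.eq_singleton_iff_unique_mem.2 ⟨?_, ?_⟩⟩
    · have hD : (isEmb_lineMap hu).range ∈ setD F := (mem_setD_iff hn _).2 ⟨u, hu, rfl, rfl⟩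
      refine ⟨⟨hD, lt_of_le_of_ne ?_ ?_⟩, (mem_line rfl).2⟩
      · rintro _ ⟨p, rfl⟩
        exact lineMap_mem h1 huY p
      · intro h
        rw [← h, hD.1] at hY
        exact lt_irrefl _ hY
    · rintro D ⟨⟨hD, -⟩, huD⟩
      exact SetLike.coe_injective (coe_eq_of_mem hD hu hn huD)
  · rintro D ⟨hD, hDY⟩
    rw [← ncard_roots_of_mem_setD hn hD]
    congr 1
    ext u
    exact ⟨fun h => ⟨h.1.1, h.2⟩, fun h => ⟨⟨h.1, hDY.le h.2⟩, h.2⟩⟩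

theorem one_mem_and_finrank_of_mem_setX {X : Subalg F} (hX : X ∈ setX F) :
    1 ∈ X ∧ Module.finrank F X.toSubmodule = 4 := by
  obtain ⟨n, hn⟩ := exists_noRoot (F := F)
  obtain ⟨u, z, hu, rfl, h1, h2, -, hz0, h⟩ := (mem_setX_iff hn X).1 hX
  exact ⟨(mem_quad h).1,
    (finrank_eq_of_coe_eq_range X (quadMap_injective hu hn h1 h2 hz0) h).trans finrank_quad⟩

/-- Trace and norm ignore the component in `F[u]z`, so `X` contains `2 * q ^ 2` roots, two for each
`D`. -/
theorem ncard_setD_lt_setX {X : Subalg F} (hX : X ∈ setX F) :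
    {D ∈ setD F | D < X}.ncard = Nat.card F ^ 2 := by
  obtain ⟨n, hn⟩ := exists_noRoot (F := F)
  have hX' := one_mem_and_finrank_of_mem_setX hX
  have h3 := ncard_setD_lt hn hX'.1 (by rw [hX'.2]; norm_num)
  obtain ⟨u, z, hu, rfl, h1, h2, hz, hz0, h⟩ := (mem_setX_iff hn X).1 hX
  have hmem : ∀ x, x ∈ X ↔ ∃ p, quadMap u z p = x := fun x => Set.ext_iff.1 h x
  have hp := bil_lineMap_eq_zero.2 ⟨h1, h2⟩
  have hf := isEmb_lineMap hu
  have key : ∀ p, tr (quadMap u z p) = 1 ∧ norm (quadMap u z p) = norm u ↔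
      p.1 = (0, 1) ∨ p.1 = (1, -1) := fun p => by
    rw [← lineMap_root_iff hu hn, quadMap, hf.norm_double hp, double_apply, tr_add, hz,
      ← bil_one_left (_ * z)]
    have h4 := hf.bil_mul_right hp (1, 0) p.2
    rw [lineMap_apply] at h4
    simp only [one_smul, zero_smul, add_zero] at h4
    rw [h4, mul_zero, add_zero, add_zero]
  have : {x : Oct F | (tr x = 1 ∧ norm x = norm u) ∧ x ∈ X} =
      quadMap u z '' (({(0, 1), (1, -1)} : Set (F × F)) ×ˢ Set.univ) := by
    ext x
    constructor
    · rintro ⟨hx, hxX⟩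
      obtain ⟨p, rfl⟩ := (hmem x).1 hxX
      exact ⟨p, ⟨(key p).1 hx, trivial⟩, rfl⟩
    · rintro ⟨p, hp, rfl⟩
      exact ⟨(key p).2 hp.1, (hmem _).2 ⟨p, rfl⟩⟩
  rw [this, Set.ncard_image_of_injective _ (quadMap_injective hu hn h1 h2 hz0), Set.ncard_prod,
    Set.ncard_pair pair_ne, Set.ncard_univ, Nat.card_prod] at h3
  linarith

theorem ncard_setD_lt_setH {H : Subalg F} (hH : H ∈ setH F) :
    {D ∈ setD F | D < H}.ncard * 2 = (Nat.card F - 1) * Nat.card F := by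
  obtain ⟨n, hn⟩ := exists_noRoot (F := F)
  rw [← ncard_roots_of_mem_setH hn hH, ncard_setD_lt hn hH.1 (by rw [hH.2.1]; norm_num)]

theorem ncard_setD : (setD F).ncard * 2 + Nat.card F ^ 3 = Nat.card F ^ 6 := by
  obtain ⟨n, hn⟩ := exists_noRoot (F := F)
  have ht : Module.finrank F (⊤ : Subalg F).toSubmodule = 8 := by
    have : (⊤ : Subalg F).toSubmodule = ⊤ := rfl
    rw [this, finrank_top, finrank_oct]
  have h := ncard_setD_lt hn (Y := ⊤) trivial (by rw [ht]; norm_num)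
  have h1 : {D ∈ setD F | D < (⊤ : Subalg F)} = setD F := by
    ext D
    refine ⟨fun h => h.1, fun hD => ⟨hD, lt_top_iff_ne_top.2 ?_⟩⟩
    rintro rfl
    have := ht.symm.trans hD.1
    omega
  have h2 : {u : Oct F | (tr u = 1 ∧ norm u = n) ∧ u ∈ (⊤ : Subalg F)} =
      {u : Oct F | tr u = 1 ∧ norm u = n} := by
    ext u
    exact ⟨fun h => h.1, fun h => ⟨h, trivial⟩⟩
  rw [h1, h2] at h
  rw [← h, ncard_roots hn]

theorem ne_zero_of_norm {y : Oct F} (h : norm y ≠ 0) : y ≠ 0 := by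
  rintro rfl; exact h norm_zero

/-- Every nonzero `z` orthogonal to `D` lies in exactly one four-dimensional subalgebra of a given
kind that contains `D`. -/
theorem ncard_quad_eq_one {A : Set (Subalg F)} {D : Subalg F} {u z : Oct F} (hu : tr u = 1)
    (hn : NoRoot (norm u)) (hDu : (D : Set (Oct F)) = Set.range (lineMap u)) (h1 : bil 1 z = 0)
    (h2 : bil u z = 0) (hz0 : z ≠ 0)
    (hA : ∀ Y ∈ A, Module.finrank F Y.toSubmodule = 4)
    (hmem : (isEmb_quadMap hu h1 h2).range ∈ A) :
    {Y ∈ {Y ∈ A | D < Y} | z ∈ Y}.ncard = 1 := by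
  have hD := (finrank_eq_of_coe_eq_range D (lineMap_injective hu hn) hDu).trans finrank_line
  rw [Set.ncard_eq_one]
  refine ⟨_, Set.eq_singleton_iff_unique_mem.2 ⟨⟨⟨hmem, lt_of_le_of_ne ?_ ?_⟩,
    (mem_quad (u := u) rfl).2.2⟩, ?_⟩⟩
  · intro x hx
    have hx' : x ∈ (D : Set (Oct F)) := hx
    rw [hDu] at hx'
    obtain ⟨p, rfl⟩ := hx'
    exact ⟨(p, 0), by rw [quadMap_apply, map_zero, zero_mul, add_zero]⟩
  · intro h
    have h4 := hA _ hmem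
    rw [← h] at h4
    omega
  · rintro Y ⟨⟨hY, hDY⟩, hzY⟩
    exact SetLike.coe_injective (coe_eq_range_of_finrank Y (quadMap_injective hu hn h1 h2 hz0)
      (quadMap_mem (hDY.le (mem_line hDu).1) (hDY.le (mem_line hDu).2) hzY)
      ((hA Y hY).trans finrank_quad.symm))

theorem ncard_lineMap_mul {u z : Oct F} (hu : tr u = 1) (hn : NoRoot (norm u)) (hz : z ≠ 0) :
    ((fun p => lineMap u p * z) '' {p | p ≠ 0}).ncard + 1 = Nat.card F ^ 2 := by
  rw [Set.ncard_image_of_injective _ (lineMap_mul_injective hu hn hz)]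
  have := Set.ncard_add_ncard_compl ({0} : Set (F × F))
  rw [Set.ncard_singleton, Nat.card_prod] at this
  rw [sq, ← this, add_comm]
  rfl

/-- All isotropic vectors of `X` lie in `F[v]z`, which is the radical of `X` and so is orthogonal to
every `u ∈ X`. Hence `u` need not be the generator `v` from the presentation of `X`. -/
theorem ncard_isotropic_of_mem_setX {X : Subalg F} (hX : X ∈ setX F) {u : Oct F} (huX : u ∈ X) :
    {y : Oct F | ((bil 1 y = 0 ∧ bil u y = 0 ∧ norm y = 0) ∧ y ≠ 0) ∧ y ∈ X}.ncard + 1 =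
      Nat.card F ^ 2 := by
  obtain ⟨n, hn⟩ := exists_noRoot (F := F)
  obtain ⟨v, z, hv, rfl, h1, h2, hz, hz0, h⟩ := (mem_setX_iff hn X).1 hX
  have hmem : ∀ x, x ∈ X ↔ ∃ p, quadMap v z p = x := fun x => Set.ext_iff.1 h x
  have hp := bil_lineMap_eq_zero.2 ⟨h1, h2⟩
  have hf := isEmb_lineMap hv
  rw [← ncard_lineMap_mul hv hn hz0]
  congr 2
  have hq : ∀ b, lineMap v b * z = quadMap v z (0, b) := fun b => by
    rw [quadMap_apply, map_zero, zero_add]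
  have hperp : ∀ x ∈ X, ∀ b, bil x (lineMap v b * z) = 0 := fun x hx b => by
    obtain ⟨p, rfl⟩ := (hmem x).1 hx
    rw [hq, quadMap, hf.bil_double hp, hz, map_zero, bil_zero_right, zero_mul, add_zero]
  ext y
  constructor
  · rintro ⟨⟨⟨-, -, hN⟩, hy0⟩, hyX⟩
    obtain ⟨⟨a, b⟩, rfl⟩ := (hmem y).1 hyX
    rw [quadMap, hf.norm_double hp, hz, mul_zero, add_zero] at hN
    obtain rfl := norm_lineMap_eq_zero hv hn hN
    refine ⟨b, ?_, hq b⟩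
    rintro rfl
    exact hy0 (map_zero _)
  · rintro ⟨b, hb, rfl⟩
    refine ⟨⟨⟨hperp _ (mem_quad h).1 b, hperp _ huX b, ?_⟩, fun h0 => hb ?_⟩, ?_⟩
    · change norm (lineMap v b * z) = 0
      rw [norm_mul, hz, mul_zero]
    · exact lineMap_mul_injective hv hn hz0 (h0.trans (by simp))
    · exact (hmem _).2 ⟨(0, b), (hq b).symm⟩

/-- The part of `H` orthogonal to `F[u]` is `F[u]z`, and its non-zero elements are all anisotropic
because `N(p z) = N(p) N(z)`. -/
theorem ncard_anisotropic_of_mem_setH {H : Subalg F} (hH : H ∈ setH F) {u : Oct F} (hu : tr u = 1)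
    (hn : NoRoot (norm u)) (huH : u ∈ H) :
    {y : Oct F | (bil 1 y = 0 ∧ bil u y = 0 ∧ norm y ≠ 0) ∧ y ∈ H}.ncard + 1 =
      Nat.card F ^ 2 := by
  obtain ⟨z, h1, h2, hz, h⟩ := exists_range_quadMap hH hu hn.disc_ne huH
  have hmem : ∀ x, x ∈ H ↔ ∃ p, quadMap u z p = x := fun x => Set.ext_iff.1 h x
  have hp := bil_lineMap_eq_zero.2 ⟨h1, h2⟩
  have hf := isEmb_lineMap hu
  rw [← ncard_lineMap_mul hu hn (ne_zero_of_norm hz)]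
  congr 2
  ext y
  constructor
  · rintro ⟨⟨hy1, hy2, hN⟩, hyH⟩
    obtain ⟨⟨a, b⟩, rfl⟩ := (hmem y).1 hyH
    have hy := bil_lineMap_eq_zero.2 ⟨hy1, hy2⟩
    have ha : a = 0 := nondeg_lineMap hu hn.disc_ne a fun r => by
      have h3 := hy r
      rwa [quadMap_apply, bil_add_right, hf.bil_mul_right hp, add_zero, bil_comm] at h3
    subst ha
    rw [quadMap_apply, map_zero, zero_add] at hN ⊢
    refine ⟨b, ?_, rfl⟩
    rintro rfl
    exact hN (by rw [map_zero, zero_mul, norm_zero])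
  · rintro ⟨b, hb, rfl⟩
    obtain ⟨hb1, hb2⟩ := bil_lineMap_mul hu h1 h2 b
    refine ⟨⟨hb1, hb2, ?_⟩, (hmem _).2 ⟨(0, b), by rw [quadMap_apply, map_zero, zero_add]⟩⟩
    rw [norm_mul]
    exact mul_ne_zero (fun h0 => hb (norm_lineMap_eq_zero hu hn h0)) hz

/-- Each non-zero isotropic vector orthogonal to `D` lies in one `X`, and each `X` has `q ^ 2 - 1`
of them; `q ^ 5 - q ^ 3 + q ^ 2 - 1 = (q ^ 2 - 1) * (q ^ 3 + 1)`. -/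
theorem ncard_setX_gt {D : Subalg F} (hD : D ∈ setD F) :
    {X ∈ setX F | D < X}.ncard = Nat.card F ^ 3 + 1 := by
  obtain ⟨n, hn⟩ := exists_noRoot (F := F)
  obtain ⟨u, hu, rfl, hDu⟩ := (mem_setD_iff hn D).1 hD
  obtain ⟨k, hk⟩ := exists_card_eq_succ (F := F)
  have h := ncard_mul_eq (fun (y : Oct F) (X : Subalg F) => y ∈ X)
    (s := {y : Oct F | (bil 1 y = 0 ∧ bil u y = 0 ∧ norm y = 0) ∧ y ≠ 0})
    (t := {X ∈ setX F | D < X}) (m := 1) (n := Nat.card F ^ 2 - 1)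
    (by
      rintro y ⟨⟨h1, h2, hy⟩, hy0⟩
      exact ncard_quad_eq_one hu hn hDu h1 h2 hy0
        (fun Y hY => (one_mem_and_finrank_of_mem_setX hY).2)
        ((mem_setX_iff hn _).2 ⟨u, y, hu, rfl, h1, h2, hy, hy0, rfl⟩))
    (by
      rintro X ⟨hX, hDX⟩
      rw [← ncard_isotropic_of_mem_setX hX (hDX.le (mem_line hDu).2), Nat.add_sub_cancel]
      rfl)
  have h3 := ncard_isotropic hu hn
  -- Writing `q = k + 2` removes the truncated subtraction.
  have h4 : Nat.card F ^ 2 - 1 = k ^ 2 + 4 * k + 3 := by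
    rw [hk, Nat.sub_eq_iff_eq_add (Nat.one_le_pow _ _ (by omega))]; ring
  rw [mul_one] at h
  rw [h, h4, hk] at h3
  rw [hk]
  refine Nat.eq_of_mul_eq_mul_right (show 0 < k ^ 2 + 4 * k + 3 by positivity) ?_
  zify at h3 ⊢
  linear_combination h3

/-- The same count with anisotropic vectors: `q ^ 6 - q ^ 5 + q ^ 3 - q ^ 2 = (q ^ 2 - 1) * (q ^ 4 -
q ^ 3 + q ^ 2)`. -/
theorem ncard_setH_gt {D : Subalg F} (hD : D ∈ setD F) :
    {H ∈ setH F | D < H}.ncard + Nat.card F ^ 3 = Nat.card F ^ 4 + Nat.card F ^ 2 := by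
  obtain ⟨n, hn⟩ := exists_noRoot (F := F)
  obtain ⟨u, hu, rfl, hDu⟩ := (mem_setD_iff hn D).1 hD
  obtain ⟨k, hk⟩ := exists_card_eq_succ (F := F)
  have h := ncard_mul_eq (fun (y : Oct F) (H : Subalg F) => y ∈ H)
    (s := {y : Oct F | bil 1 y = 0 ∧ bil u y = 0 ∧ norm y ≠ 0})
    (t := {H ∈ setH F | D < H}) (m := 1) (n := Nat.card F ^ 2 - 1)
    (by
      rintro y ⟨h1, h2, hy⟩
      exact ncard_quad_eq_one hu hn hDu h1 h2 (ne_zero_of_norm hy) (fun Y hY => hY.2.1)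
        ((mem_setH_iff hn _).2 ⟨u, y, hu, rfl, h1, h2, hy, rfl⟩))
    (by
      rintro H ⟨hH, hDH⟩
      rw [← ncard_anisotropic_of_mem_setH hH hu hn (hDH.le (mem_line hDu).2), Nat.add_sub_cancel]
      rfl)
  have h3 := ncard_anisotropic hu hn
  have h4 : Nat.card F ^ 2 - 1 = k ^ 2 + 4 * k + 3 := by
    rw [hk, Nat.sub_eq_iff_eq_add (Nat.one_le_pow _ _ (by omega))]; ring
  rw [mul_one] at h
  rw [h, h4, hk] at h3
  rw [hk]
  refine Nat.eq_of_mul_eq_mul_right (show 0 < k ^ 2 + 4 * k + 3 by positivity) ?_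
  zify at h3 ⊢
  linear_combination h3

theorem ncard_setX : (setX F).ncard * Nat.card F ^ 2 = (setD F).ncard * (Nat.card F ^ 3 + 1) :=
  (ncard_mul_eq (fun D X : Subalg F => D < X) (fun _ hD => ncard_setX_gt hD)
    (fun _ hX => ncard_setD_lt_setX hX)).symm

theorem ncard_setH : (setH F).ncard * ((Nat.card F - 1) * Nat.card F) =
    (setD F).ncard * (Nat.card F ^ 4 + Nat.card F ^ 2 - Nat.card F ^ 3) * 2 := by
  have h := ncard_mul_eq (fun D H : Subalg F => D < H)
    (m := Nat.card F ^ 4 + Nat.card F ^ 2 - Nat.card F ^ 3)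
    (n := (Nat.card F - 1) * Nat.card F / 2) (s := setD F) (t := setH F)
    (fun D hD => by rw [← ncard_setH_gt hD, Nat.add_sub_cancel])
    (fun H hH => by rw [← ncard_setD_lt_setH hH, Nat.mul_div_cancel _ two_pos])
  -- Some `H` is needed to see that `(q - 1) * q` is even, so that the division by 2 is exact.
  obtain ⟨H, hH⟩ := setH_nonempty (F := F)
  have h2 := ncard_setD_lt_setH hH
  rw [h, mul_assoc, Nat.div_mul_cancel ⟨_, by rw [← h2, mul_comm]⟩]

/-- `Aut 𝕆` acts on every set of subalgebras that it leaves invariant. -/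
def permOfInvariant {A : Set (Subalg F)} (hA : ∀ (α : Aut F) {S}, S ∈ A → α • S ∈ A) :
    Aut F →* Equiv.Perm A where
  toFun α :=
    { toFun := fun S => ⟨α • S.1, hA α S.2⟩
      invFun := fun S => ⟨α⁻¹ • S.1, hA α⁻¹ S.2⟩
      left_inv := fun S => Subtype.ext (inv_smul_smul α S.1)
      right_inv := fun S => Subtype.ext (smul_inv_smul α S.1) }
  map_one' := Equiv.ext fun S => Subtype.ext (one_smul _ S.1)
  map_mul' α β := Equiv.ext fun S => Subtype.ext (mul_smul α β S.1)

end

end Oct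

theorem mainTheorem6 (F : Type u) [Field F] [Finite F] (q : ℕ) (hq : Nat.card F = q) :
    -- `Aut 𝕆` acts by automorphisms on `𝒰` and on `𝒱`
    (∃ φ : Oct.Aut F →* (Oct.incU F).Aut, ∀ α : Oct.Aut F,
      (∀ D : Oct.setD F, ((φ α).1.1 D : Oct.setD F).1 = α • D.1) ∧
      (∀ X : Oct.setX F, ((φ α).1.2 X : Oct.setX F).1 = α • X.1)) ∧
    (∃ ψ : Oct.Aut F →* (Oct.incV F).Aut, ∀ α : Oct.Aut F,
      (∀ D : Oct.setD F, ((ψ α).1.1 D : Oct.setD F).1 = α • D.1) ∧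
      (∀ Y : ↥(Oct.setX F ∪ Oct.setH F),
        ((ψ α).1.2 Y : ↥(Oct.setX F ∪ Oct.setH F)).1 = α • Y.1)) ∧
    -- each of the three sets is an orbit
    (∃ D : Oct.Subalg F, Oct.setD F = MulAction.orbit (Oct.Aut F) D) ∧
    (∃ X : Oct.Subalg F, Oct.setX F = MulAction.orbit (Oct.Aut F) X) ∧
    (∃ H : Oct.Subalg F, Oct.setH F = MulAction.orbit (Oct.Aut F) H) ∧
    -- their lengths
    ((Oct.setD F).ncard : ℚ) = 1 / 2 * q ^ 3 * (q ^ 2 + q + 1) * (q - 1) ∧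
    ((Oct.setX F).ncard : ℚ) =
      1 / 2 * q * (q ^ 2 + q + 1) * (q - 1) * (q + 1) * (q ^ 2 - q + 1) ∧
    ((Oct.setH F).ncard : ℚ) = q ^ 4 * (q ^ 2 + q + 1) * (q ^ 2 - q + 1) ∧
    -- the local parameters
    (∀ D ∈ Oct.setD F,
      ({X ∈ Oct.setX F | D < X}.ncard : ℚ) = q ^ 3 + 1 ∧
      ({H ∈ Oct.setH F | D < H}.ncard : ℚ) = q ^ 2 * (q ^ 2 - q + 1)) ∧
    (∀ X ∈ Oct.setX F, ({D ∈ Oct.setD F | D < X}.ncard : ℚ) = q ^ 2) ∧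
    (∀ H ∈ Oct.setH F, ({D ∈ Oct.setD F | D < H}.ncard : ℚ) = 1 / 2 * q * (q - 1)) := by
  have hq2 : (2 : ℚ) ≤ q := by
    obtain ⟨k, hk⟩ := Oct.exists_card_eq_succ (F := F)
    rw [← hq, hk]; push_cast; linarith [Nat.cast_nonneg (α := ℚ) k]
  have hq0 : (q : ℚ) ≠ 0 := by linarith
  have hq1 : (q : ℚ) - 1 ≠ 0 := by linarith
  have hc1 : ((Nat.card F - 1 : ℕ) : ℚ) = q - 1 := by
    rw [Nat.cast_sub Finite.card_pos, hq, Nat.cast_one]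
  have hDc : ((Oct.setD F).ncard : ℚ) = 1 / 2 * q ^ 3 * (q ^ 2 + q + 1) * (q - 1) := by
    have h := congrArg (Nat.cast (R := ℚ)) (Oct.ncard_setD (F := F))
    rw [hq] at h
    push_cast at h
    linear_combination h / 2
  have hXH : ∀ (α : Oct.Aut F) {S}, S ∈ Oct.setX F ∪ Oct.setH F →
      α • S ∈ Oct.setX F ∪ Oct.setH F := fun α S hS =>
    hS.imp (Oct.Aut.smul_mem_setX α) (Oct.Aut.smul_mem_setH α)
  have hDD : ∀ (α : Oct.Aut F) {S}, S ∈ Oct.setD F → α • S ∈ Oct.setD F := Oct.Aut.smul_mem_setD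
  have hXX : ∀ (α : Oct.Aut F) {S}, S ∈ Oct.setX F → α • S ∈ Oct.setX F := Oct.Aut.smul_mem_setX
  refine ⟨⟨((Oct.permOfInvariant hDD).prod (Oct.permOfInvariant hXX)).codRestrict _
      fun α D X => Oct.Aut.smul_lt_smul_iff α D.1 X.1, fun α => ⟨fun _ => rfl, fun _ => rfl⟩⟩,
    ⟨((Oct.permOfInvariant hDD).prod (Oct.permOfInvariant hXH)).codRestrict _
      fun α D X => Oct.Aut.smul_lt_smul_iff α D.1 X.1, fun α => ⟨fun _ => rfl, fun _ => rfl⟩⟩,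
    Oct.eq_orbit Oct.setD_nonempty hDD Oct.exists_smul_eq_of_mem_setD,
    Oct.eq_orbit Oct.setX_nonempty hXX Oct.exists_smul_eq_of_mem_setX,
    Oct.eq_orbit Oct.setH_nonempty Oct.Aut.smul_mem_setH Oct.exists_smul_eq_of_mem_setH,
    hDc, ?_, ?_, fun D hD => ⟨?_, ?_⟩, fun X hX => ?_, fun H hH => ?_⟩
  · have h := congrArg (Nat.cast (R := ℚ)) (Oct.ncard_setX (F := F))
    rw [hq] at h
    push_cast at h
    rw [hDc] at h
    refine mul_right_cancel₀ (pow_ne_zero 2 hq0) ?_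
    linear_combination h
  · have h := congrArg (Nat.cast (R := ℚ)) (Oct.ncard_setH (F := F))
    -- A concrete `D` turns the truncated difference `q ^ 4 + q ^ 2 - q ^ 3` into a cardinality,
    -- which can be cast to `ℚ`.
    obtain ⟨D, hD⟩ := Oct.setD_nonempty (F := F)
    rw [← Oct.ncard_setH_gt hD, Nat.add_sub_cancel] at h
    have h2 := congrArg (Nat.cast (R := ℚ)) (Oct.ncard_setH_gt hD)
    rw [Nat.cast_mul, Nat.cast_mul, hc1, Nat.cast_mul, Nat.cast_mul, hDc, hq] at h
    rw [hq] at h2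
    push_cast at h h2
    refine mul_right_cancel₀ (mul_ne_zero hq1 hq0) ?_
    linear_combination h + q ^ 3 * (q ^ 2 + q + 1) * (q - 1) * h2
  · rw [Oct.ncard_setX_gt hD, hq]; push_cast; ring
  · have h2 := congrArg (Nat.cast (R := ℚ)) (Oct.ncard_setH_gt hD)
    rw [hq] at h2
    push_cast at h2
    linear_combination h2
  · rw [Oct.ncard_setD_lt_setX hX, hq]; push_cast; ring
  · have h := congrArg (Nat.cast (R := ℚ)) (Oct.ncard_setD_lt_setH hH)
    rw [Nat.cast_mul, Nat.cast_mul, hc1, hq] at h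
    push_cast at h
    linear_combination h / 2
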